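/- All random elements live on a probability space $[\Omega,\mathcal F,\mathbf P]$, and $|\cdot|_k$ is Lebesgue measure on $\mathbb R^k$. Let $\Psi=\sum_{i\in\mathbb Z}\delta_{P_i}$ be a locally finite, simple point process on $\mathbb R$ (the $P_i$ being real random variables) that is stationary, i.e. the law of $\Psi(\cdot+t)$ does not depend on $t\in\mathbb R$, with intensity $\lambda=\mathbf E\Psi([0,1])\in(0,\infty)$. Let $\Phi_0\in[0,\pi]$ and $R_0\in[0,\infty)$ be independent random variables with distribution functions $G$ and $F$, let $(\Phi_i,R_i)$, $i\in\mathbb Z$, be i.i.d. random vectors with the same distribution as the generic vector $(\Phi_0,R_0)$, and let the sequence $(\Phi_i,R_i)_{i\in\mathbb Z}$ be independent of the sequence $(P_i)_{i\in\mathbb Z}$. The cylinder process is the random set $$\Xi=\bigcup_{i\in\mathbb Z}\big(g(P_i,\Phi_i)\oplus b(\mathbf o,R_i)\big)\subset\mathbb R^2,\qquad g(p,\varphi)=\{(x,y): x\cos\varphi+y\sin\varphi=p\},$$ where $b(\mathbf o,r)$ is the closed disc of radius $r$ centred at the origin $\mathbf o$ and $\oplus$ is the Minkowski sum. For $k\ge1$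 let $\alpha^{(k)}(B_1\times\cdots\times B_k)=\mathbf E\sum^{\neq}_{i_1,\dots,i_k}\prod_{j=1}^k\mathbf 1_{B_j}(P_{i_j})$ (sum over pairwise distinct indices) be the factorial moment measures of $\Psi$, and define for bounded Borel sets $B_1,\dots,B_k\subset\mathbb R$ the factorial cumulant measures $$\gamma^{(k)}(B_1\times\cdots\times B_k)=\sum_{\ell=1}^k(-1)^{\ell-1}(\ell-1)!\sum_{K_1\cup\cdots\cup K_\ell=\{1,\dots,k\}}\ \prod_{j=1}^\ell\alpha^{(\#K_j)}\Big(\prod_{i\in K_j}B_i\Big),$$ the inner sum running over all partitions of $\{1,\dots,k\}$ into $\ell$ non-empty blocks. The reduced cumulant measure $\gamma^{(k)}_{red}$, $k\ge2$, is the signed measure on $\mathbb R^{k-1}$ with $$\gamma^{(k)}(B_1\times\cdots\times B_k)=\lambda\int_{B_1}\gamma^{(k)}_{red}\big((B_2-p)\times\cdots\times(B_k-p)\big)\,dp$$ for all bounded Borel sets $B_1,\dots,B_k$. The process $\Psi$ is called Brillinger-mixing if $\mathbf E\Psi([0,1])^k<\infty$ and $\gamma^{(k)}_{red}$ has finite total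 variation on $\mathbb R^{k-1}$, for every $k\ge2$. **Theorem.** Assume that $\Psi$ is Brillinger-mixing, that $\mathbf E R_0<\infty$, and that the distribution function $G$ of $\Phi_0$ is continuous. Let $K\subset\mathbb R^2$ be compact and star-shaped with respect to $\mathbf o$, with $\mathbf o$ an inner point of $K$. Then, with $\Xi_0=[-R_0,R_0]$, the random variable $|\Xi\cap\varrho K|_2/|\varrho K|_2$ is square-integrable for every $\varrho>0$ and $$\mathbf E\Big(\frac{|\Xi\cap\varrho K|_2}{|\varrho K|_2}-\big(1-\exp\{-\lambda\,\mathbf E|\Xi_0|_1\}\big)\Big)^2\longrightarrow0\qquad(\varrho\to\infty).$$ -/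

import Mathlib

open MeasureTheory ProbabilityTheory Filter Topology
open scoped ENNReal Nat Pointwise

noncomputable section

namespace PlanarCylinder

/-- The Euclidean plane (with Euclidean norm and Lebesgue measure). -/
abbrev Plane : Type := EuclideanSpace ℝ (Fin 2)

variable {Ω : Type*} [MeasurableSpace Ω]

/-- The counting measure `Ψ = ∑ᵢ δ_{Pᵢ}` on the real line. -/
def groundProcess (P : ℤ → Ω → ℝ) (ω : Ω) : Measure ℝ :=
  Measure.sum (fun i : ℤ => Measure.dirac (P i ω))

/-- The intensity `E Ψ([0,1])`. -/
def intensity (μ : Measure Ω) (P : ℤ → Ω → ℝ) : ℝ≥0∞ :=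
  ∫⁻ ω, groundProcess P ω (Set.Icc 0 1) ∂μ

/-- `Ψ = ∑ᵢ δ_{Pᵢ}` is a locally finite, simple, stationary point process on the real line with
positive and finite intensity. Stationarity is the invariance under translations of the law of the
random measure `Ψ`, on the `σ`-algebra generated by the maps `ψ ↦ ψ B`, `B` Borel. -/
structure IsStationaryPointProcess (μ : Measure Ω) (P : ℤ → Ω → ℝ) : Prop where
  measurable : ∀ i, Measurable (P i)
  locallyFinite : ∀ᵐ ω ∂μ, IsLocallyFiniteMeasure (groundProcess P ω)
  simple : ∀ᵐ ω ∂μ, ∀ x : ℝ, groundProcess P ω {x} ≤ 1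
  stationary : ∀ t : ℝ,
    μ.map (fun ω => (groundProcess P ω).map (fun x => x + t)) = μ.map (groundProcess P)
  intensity_pos : 0 < intensity μ P
  intensity_lt_top : intensity μ P < ∞

/-- The points `Pᵢ` carry independent marks `(Φᵢ, Rᵢ)`: these are i.i.d. copies of the generic mark
`(Φ₀, R₀)`, whose components are independent of each other and take values in `[0,π]` and `[0,∞)`,
and the sequence of marks is independent of the sequence of points. -/
structure IsIndependentMarking (μ : Measure Ω) (P Φ R : ℤ → Ω → ℝ) (Φ₀ R₀ : Ω → ℝ) : Prop where
  measurable_angle : Measurable Φ₀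
  measurable_radius : Measurable R₀
  angle_mem : ∀ᵐ ω ∂μ, Φ₀ ω ∈ Set.Icc 0 Real.pi
  radius_nonneg : ∀ᵐ ω ∂μ, 0 ≤ R₀ ω
  indep_angle_radius : IndepFun Φ₀ R₀ μ
  measurable_angles : ∀ i, Measurable (Φ i)
  measurable_radii : ∀ i, Measurable (R i)
  identDistrib : ∀ i, IdentDistrib (fun ω => (Φ i ω, R i ω)) (fun ω => (Φ₀ ω, R₀ ω)) μ μ
  iIndep_marks : iIndepFun (fun (i : ℤ) (ω : Ω) => (Φ i ω, R i ω)) μ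
  indep_points_marks :
    IndepFun (fun (ω : Ω) (i : ℤ) => P i ω) (fun (ω : Ω) (i : ℤ) => (Φ i ω, R i ω)) μ

/-- The factorial moment measure of `∑ᵢ δ_{Pᵢ}` with coordinates indexed by `κ`: the expectation of
the sum of the Dirac measures at the tuples `(P_{i(j)})_{j ∈ κ}`, over all tuples of pairwise
distinct indices `i(j)`. -/
def factorialMomentMeasure (μ : Measure Ω) (P : ℤ → Ω → ℝ) (κ : Type) : Measure (κ → ℝ) :=
  Measure.sum (fun i : κ ↪ ℤ => μ.map (fun ω j => P (i j) ω))

/-- The value of the `k`-th factorial cumulant measure on the box `B₁ × ⋯ × B_k`: the sum over all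
partitions of the index set into `ℓ` nonempty blocks `K` of `(-1)^(ℓ-1) (ℓ-1)!` times the product
of the factorial moment measures of the boxes `∏_{i ∈ K} Bᵢ`. -/
def factorialCumulant (μ : Measure Ω) (P : ℤ → Ω → ℝ) {k : ℕ} (B : Fin k → Set ℝ) : ℝ :=
  ∑ π : Finpartition (Finset.univ : Finset (Fin k)),
    (-1 : ℝ) ^ (π.parts.card - 1) * ((π.parts.card - 1)! : ℝ) *
      ∏ K ∈ π.parts,
        (factorialMomentMeasure μ P {i : Fin k // i ∈ K}).real
          (Set.univ.pi fun i : {i : Fin k // i ∈ K} => B i)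

/-- `γ` is the reduced cumulant measure of order `n + 1`:
`γ⁽ⁿ⁺¹⁾(B₀ × ⋯ × Bₙ) = λ ∫_{B₀} γ((B₁ - p) × ⋯ × (Bₙ - p)) dp` for all bounded Borel sets. -/
def IsReducedCumulantMeasure (μ : Measure Ω) (P : ℤ → Ω → ℝ) (n : ℕ)
    (γ : SignedMeasure (Fin n → ℝ)) : Prop :=
  ∀ B : Fin (n + 1) → Set ℝ, (∀ i, MeasurableSet (B i)) → (∀ i, Bornology.IsBounded (B i)) →
    factorialCumulant μ P B =
      (intensity μ P).toReal *
        ∫ p in B 0, γ (Set.univ.pi fun i : Fin n => {x : ℝ | x + p ∈ B i.succ})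

/-- Brillinger mixing: a stationary point process such that `E Ψ([0,1])^k < ∞` and the reduced
cumulant measure of order `k` has finite total variation, for all `k ≥ 2` (here `k = n + 1`). A
signed measure in the sense of Mathlib is finite, so that a reduced cumulant measure of infinite
total variation is not a `SignedMeasure`, and its finiteness is contained in the existence of
`γ`. -/
structure IsBrillingerMixing (μ : Measure Ω) (P : ℤ → Ω → ℝ) : Prop
    extends IsStationaryPointProcess μ P where
  moments : ∀ k : ℕ, 2 ≤ k → ∫⁻ ω, (groundProcess P ω (Set.Icc 0 1)) ^ k ∂μ < ∞
  reduced_cumulants : ∀ n : ℕ, 1 ≤ n → ∃ γ : SignedMeasure (Fin n → ℝ),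
    IsReducedCumulantMeasure μ P n γ ∧ γ.totalVariation Set.univ < ∞

/-- The line with normal vector `(cos θ, sin θ)` and signed distance `p` from the origin. -/
def line (p θ : ℝ) : Set Plane := {x | x 0 * Real.cos θ + x 1 * Real.sin θ = p}

/-- The cylinder process: the union of the lines `g(Pᵢ, Φᵢ)`, dilated by closed discs of radius
`Rᵢ` (Minkowski sum). -/
def cylinderProcess (P Φ R : ℤ → Ω → ℝ) (ω : Ω) : Set Plane :=
  ⋃ i : ℤ, (line (P i ω) (Φ i ω) + Metric.closedBall (0 : Plane) (R i ω))

/-- The covered area fraction `|Ξ ∩ ϱK|₂ / |ϱK|₂`. -/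
def areaFraction (P Φ R : ℤ → Ω → ℝ) (K : Set Plane) (ϱ : ℝ) (ω : Ω) : ℝ :=
  volume.real (cylinderProcess P Φ R ω ∩ ϱ • K) / volume.real (ϱ • K)

end PlanarCylinder

end

/-! After rescaling by `ϱ`, the area fraction is the mass that the uniform law on `K` gives to the
set of `y` with `ϱ • y` covered. By Fubini, mean-square convergence follows once, for distinct
nonzero `x` and `y`, the probability that `ϱ • x` is vacant tends to `a = exp(-λ E|Ξ₀|)` and the
probability that both `ϱ • x` and `ϱ • y` are vacant tends to `a ^ 2`; the exceptional points are
null (`tendsto_integral_measureReal_section_sub_sq`).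

Vacancy is a void event for the marked points. Given the points, its probability is the product of
`1 - f(Pᵢ)`, where `f p` is the probability that a cylinder located at `p` covers. If `f ≤ s` with
`s` small, this product is close to `exp(-∑ f(Pᵢ))`. The second-order reduced cumulant measure has
finite total variation, so the variance of the sum is `O(s ∫ f)` and the sum concentrates at its
mean `λ ∫ f` (`IsBrillingerMixing.exists_lintegral_tsum_sq_le`,
`IsBrillingerMixing.exists_abs_measureReal_sub_exp_le`).

Continuity of `G` gives both geometric inputs as `ϱ → ∞`. The covering probability of `ϱ • x` tends
to zero uniformly in `p`, because the projection of `x` on a random normal has no atoms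
(`measure_coverSet_le`, `tendsto_coverBound`). The locations covering `ϱ • x` and those covering `ϱ
• y` become disjoint for almost every mark, which doubles `∫ f` and squares the limit
(`tendsto_lintegral_measure_coverSet_union`). -/

noncomputable section

namespace PlanarCylinder

/-! ### Moment measures and second cumulant of the point process -/

section PointProcess

variable {Ω : Type*} {P : ℤ → Ω → ℝ}

lemma groundProcess_apply (ω : Ω) {B : Set ℝ} (hB : MeasurableSet B) :
    groundProcess P ω B = ∑' i, B.indicator 1 (P i ω) := by
  simp [groundProcess, Measure.sum_apply _ hB, Measure.dirac_apply' _ hB]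

variable [MeasurableSpace Ω] {μ : Measure Ω}

/-- The intensity measure of the point process `∑ᵢ δ_{Pᵢ}`. -/
def intensityMeasure (μ : Measure Ω) (P : ℤ → Ω → ℝ) : Measure ℝ :=
  Measure.sum fun i : ℤ => μ.map (P i)

/-- The second factorial moment measure of the point process `∑ᵢ δ_{Pᵢ}`, on `ℝ × ℝ`. -/
def pairMeasure (μ : Measure Ω) (P : ℤ → Ω → ℝ) : Measure (ℝ × ℝ) :=
  Measure.sum fun x : {x : ℤ × ℤ // x.1 ≠ x.2} => μ.map fun ω => (P x.1.1 ω, P x.1.2 ω)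

lemma measurable_groundProcess (hP : ∀ i, Measurable (P i)) : Measurable (groundProcess P) := by
  refine Measure.measurable_of_measurable_coe _ fun B hB => ?_
  simp_rw [groundProcess_apply _ hB]
  exact Measurable.tsum fun i => (measurable_one.indicator hB).comp (hP i)

lemma lintegral_tsum_points (hP : ∀ i, Measurable (P i)) {f : ℝ → ℝ≥0∞} (hf : Measurable f) :
    ∫⁻ ω, ∑' i, f (P i ω) ∂μ = ∫⁻ p, f p ∂(intensityMeasure μ P) := by
  rw [intensityMeasure, lintegral_sum_measure, lintegral_tsum fun i => by
    have := hP i; fun_prop]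
  exact tsum_congr fun i => (lintegral_map hf (hP i)).symm

lemma intensityMeasure_apply (hP : ∀ i, Measurable (P i)) {B : Set ℝ} (hB : MeasurableSet B) :
    intensityMeasure μ P B = ∫⁻ ω, groundProcess P ω B ∂μ := by
  simp_rw [groundProcess_apply _ hB]
  rw [lintegral_tsum_points hP (measurable_one.indicator hB), lintegral_indicator_one hB]

/-- The function `F` serves as the identity for the intensity and as the square for second moments.
-/
lemma IsStationaryPointProcess.lintegral_comp_translate (h : IsStationaryPointProcess μ P)
    {F : ℝ≥0∞ → ℝ≥0∞} (hF : Measurable F) {B : Set ℝ} (hB : MeasurableSet B) (t : ℝ) :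
    ∫⁻ ω, F (groundProcess P ω ((fun x => x + t) ⁻¹' B)) ∂μ =
      ∫⁻ ω, F (groundProcess P ω B) ∂μ := by
  have hm := measurable_groundProcess h.measurable
  have ht : Measurable fun x : ℝ => x + t := measurable_add_const t
  have hFB : Measurable fun ψ : Measure ℝ => F (ψ B) := hF.comp (Measure.measurable_coe hB)
  have key : ∫⁻ ψ, F (ψ B) ∂(μ.map fun ω => (groundProcess P ω).map fun x => x + t) =
      ∫⁻ ψ, F (ψ B) ∂(μ.map (groundProcess P)) := by rw [h.stationary t]
  have hmt : Measurable fun ω => (groundProcess P ω).map fun x => x + t :=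
    (Measure.measurable_map _ ht).comp hm
  rw [lintegral_map hFB hm, lintegral_map hFB hmt] at key
  simpa only [Measure.map_apply ht hB] using key

lemma IsStationaryPointProcess.lintegral_comp_Icc (h : IsStationaryPointProcess μ P)
    {F : ℝ≥0∞ → ℝ≥0∞} (hF : Measurable F) (a : ℝ) :
    ∫⁻ ω, F (groundProcess P ω (Set.Icc a (a + 1))) ∂μ =
      ∫⁻ ω, F (groundProcess P ω (Set.Icc 0 1)) ∂μ := by
  rw [← h.lintegral_comp_translate hF measurableSet_Icc a]
  simp [add_comm a]

/-- Uniqueness of Haar measure: the intensity measure is translation invariant and locally finite,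
and the unit interval fixes the constant. -/
lemma IsStationaryPointProcess.intensityMeasure_eq (h : IsStationaryPointProcess μ P) :
    intensityMeasure μ P = intensity μ P • (volume : Measure ℝ) := by
  have hunit : ∀ a, intensityMeasure μ P (Set.Icc a (a + 1)) = intensity μ P := fun a => by
    rw [intensityMeasure_apply h.measurable measurableSet_Icc]
    exact h.lintegral_comp_Icc measurable_id a
  have : IsLocallyFiniteMeasure (intensityMeasure μ P) := ⟨fun a =>
    ⟨Set.Icc (a - 1 / 2) (a - 1 / 2 + 1), Icc_mem_nhds (by linarith) (by linarith),
      (hunit _).trans_lt h.intensity_lt_top⟩⟩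
  have : (intensityMeasure μ P).IsAddLeftInvariant := ⟨fun t => by
    ext B hB
    rw [Measure.map_apply (measurable_const_add t) hB,
      intensityMeasure_apply h.measurable (measurable_const_add t hB),
      intensityMeasure_apply h.measurable hB]
    simpa [add_comm] using h.lintegral_comp_translate measurable_id hB t⟩
  have heq := Measure.isAddLeftInvariant_eq_smul (intensityMeasure μ P) (volume : Measure ℝ)
  have h1 := hunit 0
  rw [heq] at h1
  rw [heq, ← h1]
  simp

lemma pairMeasure_prod (hP : ∀ i, Measurable (P i)) {B C : Set ℝ} (hB : MeasurableSet B)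
    (hC : MeasurableSet C) :
    pairMeasure μ P (B ×ˢ C) =
      ∑' x : {x : ℤ × ℤ // x.1 ≠ x.2}, μ {ω | P x.1.1 ω ∈ B ∧ P x.1.2 ω ∈ C} := by
  rw [pairMeasure, Measure.sum_apply _ (hB.prod hC)]
  refine tsum_congr fun x => ?_
  rw [Measure.map_apply ((hP _).prodMk (hP _)) (hB.prod hC)]
  rfl

lemma lintegral_tsum_points_sq (hP : ∀ i, Measurable (P i)) {f : ℝ → ℝ≥0∞} (hf : Measurable f) :
    ∫⁻ ω, (∑' i, f (P i ω)) ^ 2 ∂μ =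
      ∫⁻ p, f p ^ 2 ∂(intensityMeasure μ P) + ∫⁻ x, f x.1 * f x.2 ∂(pairMeasure μ P) := by
  have hsq : ∀ a : ℤ → ℝ≥0∞, (∑' i, a i) ^ 2 =
      ∑' i, a i ^ 2 + ∑' x : {x : ℤ × ℤ // x.1 ≠ x.2}, a x.1.1 * a x.1.2 := by
    intro a
    have h1 : (∑' i, a i) ^ 2 = ∑' x : ℤ × ℤ, a x.1 * a x.2 := by
      rw [ENNReal.tsum_prod', sq, ← ENNReal.tsum_mul_right]
      exact tsum_congr fun i => ENNReal.tsum_mul_left.symm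
    have h2 : ∑' x : {x : ℤ × ℤ // x.1 ≠ x.2}, a x.1.1 * a x.1.2 =
        ∑' x : ℤ × ℤ, {x : ℤ × ℤ | x.1 ≠ x.2}.indicator (fun x => a x.1 * a x.2) x :=
      tsum_subtype {x : ℤ × ℤ | x.1 ≠ x.2} fun x => a x.1 * a x.2
    have h3 : ∑' i, a i ^ 2 = ∑' x : ℤ × ℤ, if x.2 = x.1 then a x.1 * a x.2 else 0 := by
      rw [ENNReal.tsum_prod']
      exact tsum_congr fun i => by simp [sq]
    rw [h1, h2, h3, ← ENNReal.tsum_add]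
    refine tsum_congr fun x => ?_
    by_cases hx : x.2 = x.1
    · simp [hx]
    · simp [hx, Ne.symm hx]
  have hmul : Measurable fun x : ℝ × ℝ => f x.1 * f x.2 :=
    (hf.comp measurable_fst).mul (hf.comp measurable_snd)
  simp_rw [hsq]
  rw [lintegral_add_left (Measurable.tsum fun i => by have := hP i; fun_prop),
    lintegral_tsum_points hP (hf.pow_const 2), pairMeasure, lintegral_sum_measure, lintegral_tsum
      fun x => by have := hP x.1.1; have := hP x.1.2; fun_prop]
  congr 1
  exact tsum_congr fun x => (lintegral_map hmul ((hP x.1.1).prodMk (hP x.1.2))).symm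

/-- Restoring the diagonal pairs gives `E Ψ(B)Ψ(C)`, and a product is at most the square of its
larger factor. The resulting local finiteness lets cumulant identities between reals be lifted to
measures. -/
lemma pairMeasure_prod_le (hP : ∀ i, Measurable (P i)) {B C : Set ℝ} (hB : MeasurableSet B)
    (hC : MeasurableSet C) :
    pairMeasure μ P (B ×ˢ C) ≤
      ∫⁻ ω, groundProcess P ω B ^ 2 ∂μ + ∫⁻ ω, groundProcess P ω C ^ 2 ∂μ := by
  have hind : ∀ {D : Set ℝ}, MeasurableSet D → Measurable (D.indicator (1 : ℝ → ℝ≥0∞)) :=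
    fun hD => measurable_one.indicator hD
  have hmeas : Measurable fun ω => ∑' i, B.indicator (1 : ℝ → ℝ≥0∞) (P i ω) :=
    Measurable.tsum fun i => (hind hB).comp (hP i)
  rw [pairMeasure_prod hP hB hC]
  simp_rw [groundProcess_apply _ hB, groundProcess_apply _ hC]
  rw [← lintegral_add_left (hmeas.pow_const 2)]
  calc ∑' x : {x : ℤ × ℤ // x.1 ≠ x.2}, μ {ω | P x.1.1 ω ∈ B ∧ P x.1.2 ω ∈ C}
      = ∑' x : {x : ℤ × ℤ // x.1 ≠ x.2}, ∫⁻ ω, B.indicator 1 (P x.1.1 ω) *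
          C.indicator 1 (P x.1.2 ω) ∂μ := by
        refine tsum_congr fun x => ?_
        rw [← lintegral_indicator_one (s := {ω | P x.1.1 ω ∈ B ∧ P x.1.2 ω ∈ C})
          ((hP _ hB).inter (hP _ hC))]
        refine lintegral_congr fun ω => ?_
        by_cases h1 : P x.1.1 ω ∈ B <;> by_cases h2 : P x.1.2 ω ∈ C <;>
          simp [Set.indicator, h1, h2]
    _ ≤ ∑' x : ℤ × ℤ, ∫⁻ ω, B.indicator 1 (P x.1 ω) * C.indicator 1 (P x.2 ω) ∂μ :=
        ENNReal.tsum_comp_le_tsum_of_injective Subtype.val_injective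
          fun x : ℤ × ℤ => ∫⁻ ω, B.indicator 1 (P x.1 ω) * C.indicator 1 (P x.2 ω) ∂μ
    _ = ∫⁻ ω, (∑' i, B.indicator 1 (P i ω)) * ∑' i, C.indicator 1 (P i ω) ∂μ := by
        have hB' := hind hB
        have hC' := hind hC
        rw [← lintegral_tsum fun x => by have := hP x.1; have := hP x.2; fun_prop]
        refine lintegral_congr fun ω => ?_
        rw [ENNReal.tsum_prod', ← ENNReal.tsum_mul_right]
        simp_rw [ENNReal.tsum_mul_left]
    _ ≤ _ := by
        refine lintegral_mono fun ω => ?_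
        rcases le_total (∑' i, B.indicator (1 : ℝ → ℝ≥0∞) (P i ω))
          (∑' i, C.indicator (1 : ℝ → ℝ≥0∞) (P i ω)) with h | h
        · refine le_trans ?_ le_add_self
          rw [sq]; gcongr
        · refine le_trans ?_ le_self_add
          rw [sq]; gcongr

lemma IsBrillingerMixing.isLocallyFiniteMeasure_pairMeasure (h : IsBrillingerMixing μ P) :
    IsLocallyFiniteMeasure (pairMeasure μ P) := by
  refine ⟨fun x => ⟨Set.Icc (x.1 - 1 / 2) (x.1 - 1 / 2 + 1) ×ˢ
    Set.Icc (x.2 - 1 / 2) (x.2 - 1 / 2 + 1), ?_, ?_⟩⟩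
  · exact prod_mem_nhds (Icc_mem_nhds (by linarith) (by linarith))
      (Icc_mem_nhds (by linarith) (by linarith))
  · refine (pairMeasure_prod_le h.measurable measurableSet_Icc measurableSet_Icc).trans_lt ?_
    rw [h.lintegral_comp_Icc (F := fun x => x ^ 2) (by fun_prop),
      h.lintegral_comp_Icc (F := fun x => x ^ 2) (by fun_prop)]
    exact ENNReal.add_lt_top.2 ⟨h.moments 2 le_rfl, h.moments 2 le_rfl⟩

lemma pairMeasure_prod_lt_top (h : IsBrillingerMixing μ P) {B C : Set ℝ}
    (hB : Bornology.IsBounded B) (hC : Bornology.IsBounded C) :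
    pairMeasure μ P (B ×ˢ C) < ∞ := by
  have := h.isLocallyFiniteMeasure_pairMeasure
  exact (hB.prod hC).measure_lt_top

lemma factorialMomentMeasure_pair (hP : ∀ i, Measurable (P i)) {B : Fin 2 → Set ℝ}
    (hB : ∀ i, MeasurableSet (B i)) :
    factorialMomentMeasure μ P {i : Fin 2 // i ∈ Finset.univ}
      (Set.univ.pi fun i : {i : Fin 2 // i ∈ Finset.univ} => B i) =
      pairMeasure μ P (B 0 ×ˢ B 1) := by
  have hpi : MeasurableSet (Set.univ.pi fun i : {i : Fin 2 // i ∈ Finset.univ} => B i) :=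
    MeasurableSet.univ_pi fun i => hB i.1
  rw [pairMeasure_prod hP (hB 0) (hB 1), factorialMomentMeasure,
    Measure.sum_apply _ hpi]
  let e : ({i : Fin 2 // i ∈ Finset.univ} ↪ ℤ) ≃ {x : ℤ × ℤ // x.1 ≠ x.2} :=
    { toFun := fun f => ⟨(f ⟨0, Finset.mem_univ _⟩, f ⟨1, Finset.mem_univ _⟩), by simp⟩
      invFun := fun x => ⟨fun i => if i.1 = 0 then x.1.1 else x.1.2, by
        rintro ⟨i, _⟩ ⟨j, _⟩
        have := x.2
        fin_cases i <;> fin_cases j <;> simp [this, this.symm]⟩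
      left_inv := fun f => by
        ext ⟨i, _⟩
        fin_cases i <;> simp
      right_inv := fun x => by simp }
  rw [← e.tsum_eq]
  refine tsum_congr fun f => ?_
  rw [Measure.map_apply (measurable_pi_lambda _ fun i => hP _) hpi]
  congr 1
  ext ω
  simp [e, Set.mem_pi, Fin.forall_fin_two]

lemma factorialMomentMeasure_singleton (hP : ∀ i, Measurable (P i)) {B : Fin 2 → Set ℝ}
    (hB : ∀ i, MeasurableSet (B i)) (a : Fin 2) :
    factorialMomentMeasure μ P {i : Fin 2 // i ∈ ({a} : Finset (Fin 2))}
      (Set.univ.pi fun i : {i : Fin 2 // i ∈ ({a} : Finset (Fin 2))} => B i) =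
      intensityMeasure μ P (B a) := by
  have hpi : MeasurableSet (Set.univ.pi fun i : {i : Fin 2 // i ∈ ({a} : Finset (Fin 2))} => B i) :=
    MeasurableSet.univ_pi fun i => hB i.1
  let u : Unique {i : Fin 2 // i ∈ ({a} : Finset (Fin 2))} :=
    { default := ⟨a, Finset.mem_singleton_self a⟩
      uniq := fun i => Subtype.ext (Finset.mem_singleton.1 i.2) }
  let e : ({i : Fin 2 // i ∈ ({a} : Finset (Fin 2))} ↪ ℤ) ≃ ℤ := Equiv.uniqueEmbeddingEquivResult
  rw [factorialMomentMeasure, Measure.sum_apply _ hpi,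
    intensityMeasure, Measure.sum_apply _ (hB a), ← e.tsum_eq]
  refine tsum_congr fun f => ?_
  rw [Measure.map_apply (measurable_pi_lambda _ fun i => hP _) hpi, Measure.map_apply (hP _) (hB a)]
  congr 1
  ext ω
  simp only [Set.mem_preimage, Set.mem_univ_pi]
  exact ⟨fun h => h default, fun h i => by rw [Unique.eq_default i]; exact h⟩

/-- Two points have just two partitions: the single block, with coefficient `1`, and the two
singletons, with coefficient `-1`. -/
lemma factorialCumulant_two (hP : ∀ i, Measurable (P i)) {B : Fin 2 → Set ℝ}
    (hB : ∀ i, MeasurableSet (B i)) :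
    factorialCumulant μ P B = (pairMeasure μ P).real (B 0 ×ˢ B 1) -
      (intensityMeasure μ P).real (B 0) * (intensityMeasure μ P).real (B 1) := by
  have hne : (Finset.univ : Finset (Fin 2)) ≠ ⊥ := by decide
  have huniv : ∀ h : (Finset.univ : Finset (Fin 2)) ≠ ⊥,
      (Finset.univ : Finset (Finpartition (Finset.univ : Finset (Fin 2)))) =
        {Finpartition.indiscrete h, ⊥} := by decide
  have hdiff : ∀ h : (Finset.univ : Finset (Fin 2)) ≠ ⊥, Finpartition.indiscrete h ≠ ⊥ := by
    decide
  have hbot : (⊥ : Finpartition (Finset.univ : Finset (Fin 2))).parts = {{0}, {1}} := by decide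
  have hpair : ({0} : Finset (Fin 2)) ≠ {1} := by decide
  rw [factorialCumulant, huniv hne, Finset.sum_pair (hdiff hne), Finpartition.indiscrete_parts, hbot,
    Finset.prod_singleton, Finset.prod_pair hpair, Finset.card_pair hpair]
  simp only [measureReal_def, factorialMomentMeasure_pair hP hB,
    factorialMomentMeasure_singleton hP hB]
  simp
  ring

end PointProcess

/-! ### Variance bound from the second reduced cumulant -/

section SecondMoment

variable {Ω : Type*} [MeasurableSpace Ω] {μ : Measure Ω} {P : ℤ → Ω → ℝ}

/-- The image of `dp ⊗ g` under the shear `(p, q) ↦ (p, q + p)`. -/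
def shearMeasure (g : Measure ℝ) : Measure (ℝ × ℝ) :=
  ((volume : Measure ℝ).prod g).map fun z => (z.1, z.2 + z.1)

lemma measurable_shear : Measurable fun z : ℝ × ℝ => (z.1, z.2 + z.1) := by fun_prop

lemma measurable_measure_translate (g : Measure ℝ) [IsFiniteMeasure g] {C : Set ℝ}
    (hC : MeasurableSet C) : Measurable fun p => g {x | x + p ∈ C} := by
  have : MeasurableSet {z : ℝ × ℝ | z.2 + z.1 ∈ C} :=
    (measurable_snd.add measurable_fst) hC
  exact measurable_measure_prodMk_left this

lemma shearMeasure_prod (g : Measure ℝ) [IsFiniteMeasure g] {B C : Set ℝ}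
    (hB : MeasurableSet B) (hC : MeasurableSet C) :
    shearMeasure g (B ×ˢ C) = ∫⁻ p in B, g {x | x + p ∈ C} := by
  rw [shearMeasure, Measure.map_apply measurable_shear (hB.prod hC),
    Measure.prod_apply (measurable_shear (hB.prod hC)), ← lintegral_indicator hB]
  refine lintegral_congr fun p => ?_
  by_cases hp : p ∈ B
  · rw [Set.indicator_of_mem hp]
    congr 1
    ext x
    simp [hp]
  · rw [Set.indicator_of_notMem hp, ← measure_empty (μ := g)]
    congr 1
    ext x
    simp [hp]

lemma shearMeasure_prod_lt_top (g : Measure ℝ) [IsFiniteMeasure g] {B C : Set ℝ}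
    (hB : MeasurableSet B) (hBb : Bornology.IsBounded B) (hC : MeasurableSet C) :
    shearMeasure g (B ×ˢ C) < ∞ := by
  rw [shearMeasure_prod g hB hC]
  calc ∫⁻ p in B, g {x | x + p ∈ C} ≤ ∫⁻ _ in B, g Set.univ :=
        lintegral_mono fun p => measure_mono (Set.subset_univ _)
    _ = g Set.univ * volume B := by simp
    _ < ∞ := ENNReal.mul_lt_top (measure_lt_top _ _) hBb.measure_lt_top

lemma shearMeasure_real_prod (g : Measure ℝ) [IsFiniteMeasure g] {B C : Set ℝ}
    (hB : MeasurableSet B) (hC : MeasurableSet C) :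
    (shearMeasure g).real (B ×ˢ C) = ∫ p in B, g.real {x | x + p ∈ C} := by
  rw [measureReal_def, shearMeasure_prod g hB hC, ← integral_toReal
    (measurable_measure_translate g hC).aemeasurable (ae_of_all _ fun _ => measure_lt_top _ _)]
  rfl

lemma integrableOn_measure_translate (g : Measure ℝ) [IsFiniteMeasure g] {B C : Set ℝ}
    (hB : MeasurableSet B) (hBb : Bornology.IsBounded B) (hC : MeasurableSet C) :
    IntegrableOn (fun p => g.real {x | x + p ∈ C}) B := by
  refine integrable_toReal_of_lintegral_ne_top
    (measurable_measure_translate g hC).aemeasurable ?_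
  rw [← shearMeasure_prod g hB hC]
  exact (shearMeasure_prod_lt_top g hB hBb hC).ne

/-- The defining relation of the reduced cumulant measure of order two, for measures. -/
lemma IsBrillingerMixing.exists_pairMeasure_add_eq (h : IsBrillingerMixing μ P) :
    ∃ g g' : Measure ℝ, IsFiniteMeasure g ∧ IsFiniteMeasure g' ∧
      pairMeasure μ P + intensity μ P • shearMeasure g' =
        (intensityMeasure μ P).prod (intensityMeasure μ P) +
          intensity μ P • shearMeasure g := by
  obtain ⟨γ, hγ, -⟩ := h.reduced_cumulants 1 le_rfl
  have hev : Measurable fun f : Fin 1 → ℝ => f 0 := measurable_pi_apply 0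
  -- The two Jordan parts of `γ`, moved from `Fin 1 → ℝ` to `ℝ`. The negative part stands on the
  -- left of the identity, so that no subtraction of infinite measures occurs.
  refine ⟨γ.toJordanDecomposition.posPart.map fun f => f 0,
    γ.toJordanDecomposition.negPart.map fun f => f 0, inferInstance, inferInstance, ?_⟩
  set g := γ.toJordanDecomposition.posPart.map fun f => f 0
  set g' := γ.toJordanDecomposition.negPart.map fun f => f 0
  have hN := h.intensityMeasure_eq
  have hl := h.intensity_lt_top
  have hNfin : ∀ {B : Set ℝ}, Bornology.IsBounded B → intensityMeasure μ P B < ∞ := fun hB => by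
    rw [hN]
    exact ENNReal.mul_lt_top hl hB.measure_lt_top
  have : SigmaFinite (intensityMeasure μ P) := by
    rw [hN, ← ENNReal.coe_toNNReal hl.ne]
    exact inferInstanceAs (SigmaFinite ((intensity μ P).toNNReal • (volume : Measure ℝ)))
  -- On bounded boxes all four terms are finite, so the real-valued cumulant relation can be read in
  -- `ℝ≥0∞`.
  have hbox : ∀ B C : Set ℝ, MeasurableSet B → MeasurableSet C → Bornology.IsBounded B →
      Bornology.IsBounded C → (pairMeasure μ P + intensity μ P • shearMeasure g') (B ×ˢ C) < ∞ ∧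
      (pairMeasure μ P + intensity μ P • shearMeasure g') (B ×ˢ C) =
        ((intensityMeasure μ P).prod (intensityMeasure μ P) +
          intensity μ P • shearMeasure g) (B ×ˢ C) := by
    intro B C hB hC hBb hCb
    have hfin := pairMeasure_prod_lt_top h hBb hCb
    have hg := ENNReal.mul_lt_top hl (shearMeasure_prod_lt_top g hB hBb hC)
    have hg' := ENNReal.mul_lt_top hl (shearMeasure_prod_lt_top g' hB hBb hC)
    have hNN := ENNReal.mul_lt_top (hNfin hBb) (hNfin hCb)
    have hcum := hγ ![B, C] (Fin.forall_fin_two.2 ⟨hB, hC⟩) (Fin.forall_fin_two.2 ⟨hBb, hCb⟩)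
    rw [factorialCumulant_two h.measurable (Fin.forall_fin_two.2 ⟨hB, hC⟩)] at hcum
    have hint : ∀ p : ℝ, γ (Set.univ.pi fun i : Fin 1 =>
        {x : ℝ | x + p ∈ (![B, C] : Fin 2 → Set ℝ) i.succ}) =
        g.real {x | x + p ∈ C} - g'.real {x | x + p ∈ C} := by
      intro p
      have hCp : MeasurableSet {x | x + p ∈ C} := measurable_add_const p hC
      have hset : (Set.univ.pi fun i : Fin 1 =>
          {x : ℝ | x + p ∈ (![B, C] : Fin 2 → Set ℝ) i.succ}) =
          (fun f : Fin 1 → ℝ => f 0) ⁻¹' {x | x + p ∈ C} := by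
        ext f
        simp
      rw [hset, γ.apply_eq_posPart_real_sub_negPart_real (hev hCp), map_measureReal_apply hev hCp,
        map_measureReal_apply hev hCp]
    simp_rw [hint] at hcum
    simp only [Matrix.cons_val_zero, Matrix.cons_val_one] at hcum
    rw [integral_sub (integrableOn_measure_translate g hB hBb hC)
      (integrableOn_measure_translate g' hB hBb hC), ← shearMeasure_real_prod g hB hC,
      ← shearMeasure_real_prod g' hB hC] at hcum
    simp only [Measure.coe_add, Pi.add_apply, Measure.smul_apply, smul_eq_mul, Measure.prod_prod]
    refine ⟨ENNReal.add_lt_top.2 ⟨hfin, hg'⟩, ?_⟩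
    rw [← ENNReal.toReal_eq_toReal_iff' (ENNReal.add_lt_top.2 ⟨hfin, hg'⟩).ne
      (ENNReal.add_lt_top.2 ⟨hNN, hg⟩).ne, ENNReal.toReal_add hfin.ne hg'.ne,
      ENNReal.toReal_add hNN.ne hg.ne, ENNReal.toReal_mul, ENNReal.toReal_mul, ENNReal.toReal_mul]
    simp only [measureReal_def] at hcum
    linarith
  -- Exhaustion by bounded squares: on each, both sides are finite measures agreeing on rectangles.
  let I : ℕ → Set ℝ := fun n => Set.Icc (-n : ℝ) n
  have hcover : ⋃ n, I n ×ˢ I n = Set.univ := by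
    refine Set.eq_univ_of_forall fun x => Set.mem_iUnion.2 ?_
    obtain ⟨n, hn⟩ := exists_nat_ge (max |x.1| |x.2|)
    exact ⟨n, abs_le.1 ((le_max_left _ _).trans hn), abs_le.1 ((le_max_right _ _).trans hn)⟩
  rw [← Measure.restrict_univ (μ := pairMeasure μ P + _), ← hcover,
    ← Measure.restrict_univ (μ := Measure.prod _ _ + _), ← hcover, Measure.restrict_iUnion_congr]
  intro n
  have hI : MeasurableSet (I n) := measurableSet_Icc
  have hIb : Bornology.IsBounded (I n) := Metric.isBounded_Icc _ _
  have : IsFiniteMeasure ((pairMeasure μ P + intensity μ P • shearMeasure g').restrict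
      (I n ×ˢ I n)) := ⟨by
    rw [Measure.restrict_apply_univ]
    exact (hbox _ _ hI hI hIb hIb).1⟩
  refine Measure.ext_prod fun {s t} hs ht => ?_
  rw [Measure.restrict_apply (hs.prod ht), Measure.restrict_apply (hs.prod ht),
    Set.prod_inter_prod]
  exact (hbox _ _ (hs.inter hI) (ht.inter hI) (hIb.subset Set.inter_subset_right)
    (hIb.subset Set.inter_subset_right)).2

/-- Undoing the shear turns the integrand into `f p * f (q + p)`; bounding the second factor by `s`
leaves a product integral. -/
lemma lintegral_mul_shearMeasure_le (g : Measure ℝ) [IsFiniteMeasure g] {f : ℝ → ℝ≥0∞}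
    (hf : Measurable f) {s : ℝ≥0∞} (hs : ∀ p, f p ≤ s) :
    ∫⁻ x, f x.1 * f x.2 ∂(shearMeasure g) ≤ s * g Set.univ * ∫⁻ p, f p := by
  rw [shearMeasure, lintegral_map (by fun_prop) measurable_shear]
  calc ∫⁻ z, f z.1 * f (z.2 + z.1) ∂((volume : Measure ℝ).prod g)
      ≤ ∫⁻ z, f z.1 * (fun _ => s) z.2 ∂((volume : Measure ℝ).prod g) :=
        lintegral_mono fun z => mul_le_mul_right (hs _) _
    _ = s * g Set.univ * ∫⁻ p, f p := by
        rw [lintegral_prod_mul hf.aemeasurable aemeasurable_const, lintegral_const, mul_comm]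

/-- The variance of `∑ᵢ f(Pᵢ)` is at most a constant multiple of `sup f * ∫ f`. -/
lemma IsBrillingerMixing.exists_lintegral_tsum_sq_le (h : IsBrillingerMixing μ P) :
    ∃ C : ℝ≥0∞, C < ∞ ∧ ∀ (f : ℝ → ℝ≥0∞) (s : ℝ≥0∞), Measurable f → (∀ p, f p ≤ s) →
      ∫⁻ ω, (∑' i, f (P i ω)) ^ 2 ∂μ ≤
        (intensity μ P * ∫⁻ p, f p) ^ 2 + C * s * ∫⁻ p, f p := by
  obtain ⟨g, g', _, _, hgg⟩ := h.exists_pairMeasure_add_eq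
  -- In the constant, `1` pays for the diagonal terms and `g Set.univ` for the positive part of the
  -- cumulant.
  refine ⟨intensity μ P * (1 + g Set.univ), ENNReal.mul_lt_top h.intensity_lt_top
    (ENNReal.add_lt_top.2 ⟨ENNReal.one_lt_top, measure_lt_top _ _⟩), fun f s hf hs => ?_⟩
  have hN := h.intensityMeasure_eq
  have : SigmaFinite (intensityMeasure μ P) := by
    rw [hN, ← ENNReal.coe_toNNReal h.intensity_lt_top.ne]
    exact inferInstanceAs (SigmaFinite ((intensity μ P).toNNReal • (volume : Measure ℝ)))
  have hNf : ∫⁻ p, f p ∂(intensityMeasure μ P) = intensity μ P * ∫⁻ p, f p := by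
    rw [hN, lintegral_smul_measure, smul_eq_mul]
  have hpair : ∫⁻ x, f x.1 * f x.2 ∂(pairMeasure μ P) ≤
      (intensity μ P * ∫⁻ p, f p) ^ 2 + intensity μ P * (s * g Set.univ * ∫⁻ p, f p) :=
    calc ∫⁻ x, f x.1 * f x.2 ∂(pairMeasure μ P)
        -- Adding the negative part only enlarges the integral, so `g'` never enters the bound.
        ≤ ∫⁻ x, f x.1 * f x.2 ∂(pairMeasure μ P + intensity μ P • shearMeasure g') :=
          lintegral_mono' (Measure.le_add_right le_rfl) le_rfl
      _ ≤ _ := by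
          rw [hgg, lintegral_add_measure, lintegral_smul_measure, smul_eq_mul,
            lintegral_prod_mul hf.aemeasurable hf.aemeasurable, hNf, sq]
          gcongr
          exact lintegral_mul_shearMeasure_le g hf hs
  have hdiag : ∫⁻ p, f p ^ 2 ∂(intensityMeasure μ P) ≤ s * (intensity μ P * ∫⁻ p, f p) := by
    rw [← hNf, ← lintegral_const_mul _ hf]
    refine lintegral_mono fun p => ?_
    rw [sq]
    gcongr
    exact hs p
  rw [lintegral_tsum_points_sq h.measurable hf]
  refine (add_le_add hdiag hpair).trans_eq ?_
  ring

end SecondMoment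

/-! ### Void probabilities and their exponential approximation -/

section VoidProbability

lemma exp_neg_sub_exp_neg_le {a b : ℝ} (ha : 0 ≤ a) :
    Real.exp (-a) - Real.exp (-b) ≤ |a - b| := by
  have h1 : Real.exp (-b) = Real.exp (-a) * Real.exp (a - b) := by
    rw [← Real.exp_add]; congr 1; ring
  have h2 := Real.add_one_le_exp (a - b)
  have h3 : Real.exp (-a) ≤ 1 := Real.exp_le_one_iff.2 (by linarith)
  have h4 := Real.exp_pos (-a)
  have h5 := neg_abs_le (a - b)
  rw [h1]
  nlinarith [abs_nonneg (a - b)]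

/-- This follows from `log (1 - b) ≥ 1 - 1 / (1 - b) = -b / (1 - b)` and `1 / (1 - b) ≤ 1 + 2 * s`
for `b ≤ s ≤ 1 / 2`. -/
lemma exp_neg_le_one_sub {b s : ℝ} (hb : 0 ≤ b) (hbs : b ≤ s) (hs : s ≤ 1 / 2) :
    Real.exp (-((1 + 2 * s) * b)) ≤ 1 - b := by
  have hpos : 0 < 1 - b := by linarith
  rw [← Real.le_log_iff_exp_le hpos]
  refine le_trans ?_ (Real.one_sub_inv_le_log_of_pos hpos)
  have h : (1 - b)⁻¹ ≤ 1 + (1 + 2 * s) * b := by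
    rw [inv_le_iff_one_le_mul₀ hpos]
    nlinarith [mul_nonneg hb (sub_nonneg.2 hbs), mul_nonneg hb hb,
      mul_nonneg (mul_nonneg hb hb) (sub_nonneg.2 hs)]
  linarith

/-- The bounds hold factor by factor and pass to the limit over finite subproducts; the infinite
product converges because its factors are at most one. -/
lemma tprod_one_sub_bounds {ι : Type*} {a : ι → ℝ≥0∞} {s : ℝ} (hs0 : 0 ≤ s)
    (hs : s ≤ 1 / 2) (has : ∀ i, a i ≤ ENNReal.ofReal s) (hsum : ∑' i, a i ≠ ∞) :
    ENNReal.ofReal (Real.exp (-((1 + 2 * s) * (∑' i, a i).toReal))) ≤ ∏' i, (1 - a i) ∧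
      ∏' i, (1 - a i) ≤ ENNReal.ofReal (Real.exp (-(∑' i, a i).toReal)) := by
  have hfin : ∀ i, a i ≠ ∞ := ENNReal.ne_top_of_tsum_ne_top hsum
  have hprod : Tendsto (fun F : Finset ι => ∏ i ∈ F, (1 - a i)) atTop (𝓝 (∏' i, (1 - a i))) :=
    (ENNReal.multipliable_of_le_one fun i => tsub_le_self).hasProd
  have hS : Tendsto (fun F : Finset ι => ∑ i ∈ F, (a i).toReal) atTop
      (𝓝 (∑' i, a i).toReal) := by
    rw [ENNReal.tsum_toReal_eq hfin]
    exact (ENNReal.summable_toReal hsum).hasSum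
  have hb : ∀ i, (a i).toReal ≤ s := fun i => ENNReal.toReal_le_of_le_ofReal hs0 (has i)
  have hF : ∀ F : Finset ι, ∏ i ∈ F, (1 - a i) = ENNReal.ofReal (∏ i ∈ F, (1 - (a i).toReal)) := by
    intro F
    rw [ENNReal.ofReal_prod_of_nonneg fun i _ => by linarith [hb i]]
    refine Finset.prod_congr rfl fun i _ => ?_
    rw [ENNReal.ofReal_sub _ ENNReal.toReal_nonneg, ENNReal.ofReal_one,
      ENNReal.ofReal_toReal (hfin i)]
  constructor
  · refine le_of_tendsto_of_tendsto' (ENNReal.tendsto_ofReal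
      ((Real.continuous_exp.tendsto _).comp (hS.const_mul (1 + 2 * s)).neg)) hprod fun F => ?_
    rw [hF]
    refine ENNReal.ofReal_le_ofReal ?_
    simp only [Function.comp_apply]
    rw [Finset.mul_sum, ← Finset.sum_neg_distrib, Real.exp_sum]
    exact Finset.prod_le_prod (fun i _ => (Real.exp_pos _).le)
      fun i _ => exp_neg_le_one_sub ENNReal.toReal_nonneg (hb i) hs
  · refine le_of_tendsto_of_tendsto' hprod (ENNReal.tendsto_ofReal
      ((Real.continuous_exp.tendsto _).comp hS.neg)) fun F => ?_
    rw [hF]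
    refine ENNReal.ofReal_le_ofReal ?_
    simp only [Function.comp_apply]
    rw [← Finset.sum_neg_distrib, Real.exp_sum]
    refine Finset.prod_le_prod (fun i _ => by linarith [hb i]) fun i _ => ?_
    linarith [Real.add_one_le_exp (-(a i).toReal)]

variable {Ω X : Type*} [MeasurableSpace Ω] [MeasurableSpace X] {μ : Measure Ω}
  [IsProbabilityMeasure μ] {P : ℤ → Ω → ℝ} {M : ℤ → Ω → X} {ν : Measure X}

/-- The probability that a marked point process has no point in `A`, given the i.i.d. marks are
independent of the points. -/
lemma measure_forall_notMem_eq [IsProbabilityMeasure ν] (hP : ∀ i, Measurable (P i))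
    (hM : ∀ i, Measurable (M i)) (hν : ∀ i, μ.map (M i) = ν) (hMM : iIndepFun M μ)
    (hPM : IndepFun (fun ω i => P i ω) (fun ω i => M i ω) μ) {A : Set (X × ℝ)}
    (hA : MeasurableSet A) :
    μ {ω | ∀ i, (M i ω, P i ω) ∉ A} = ∫⁻ ω, ∏' i, (1 - ν {m | (m, P i ω) ∈ A}) ∂μ := by
  have hPs : Measurable fun ω i => P i ω := measurable_pi_lambda _ hP
  have hMs : Measurable fun ω i => M i ω := measurable_pi_lambda _ hM
  have hE : MeasurableSet {z : (ℤ → ℝ) × (ℤ → X) | ∀ i, (z.2 i, z.1 i) ∉ A} := by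
    simp only [Set.ofPred_forall]
    refine MeasurableSet.iInter fun i => ?_
    have : Measurable fun z : (ℤ → ℝ) × (ℤ → X) => (z.2 i, z.1 i) := by fun_prop
    exact this hA.compl
  have hlaw : μ.map (fun ω i => M i ω) = Measure.infinitePi fun _ => ν := by
    rw [(iIndepFun_iff_map_fun_eq_infinitePi_map hM).1 hMM]
    simp_rw [hν]
  have hjoint := (indepFun_iff_map_prod_eq_prod_map_map hPs.aemeasurable hMs.aemeasurable).1 hPM
  have hsec : Measurable fun p : ℤ → ℝ => Measure.infinitePi (fun _ : ℤ => ν)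
      {m : ℤ → X | ∀ i, (m i, p i) ∉ A} := measurable_measure_prodMk_left hE
  calc μ {ω | ∀ i, (M i ω, P i ω) ∉ A}
      = μ.map (fun ω => ((fun i => P i ω), fun i => M i ω))
          {z : (ℤ → ℝ) × (ℤ → X) | ∀ i, (z.2 i, z.1 i) ∉ A} := by
        rw [Measure.map_apply (hPs.prodMk hMs) hE]
        rfl
    _ = ∫⁻ ω, Measure.infinitePi (fun _ : ℤ => ν) {m | ∀ i, (m i, P i ω) ∉ A} ∂μ := by
        rw [hjoint, hlaw, Measure.prod_apply hE]
        exact lintegral_map hsec hPs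
    _ = _ := by
        refine lintegral_congr fun ω => ?_
        have hAp : ∀ p, MeasurableSet {m | (m, p) ∈ A} := fun p => measurable_prodMk_right hA
        have hset : {m : ℤ → X | ∀ i, (m i, P i ω) ∉ A} =
            Set.univ.pi fun i => {m | (m, P i ω) ∈ A}ᶜ := by
          ext m
          simp
        rw [hset, Measure.infinitePi_pi_univ _ fun i => (hAp _).compl]
        exact tprod_congr fun i => prob_compl_eq_one_sub (hAp _)

/-- Poisson approximation of void probabilities of independently marked Brillinger-mixing point
processes. -/
lemma IsBrillingerMixing.exists_abs_measureReal_sub_exp_le (h : IsBrillingerMixing μ P)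
    [IsProbabilityMeasure ν] (hM : ∀ i, Measurable (M i)) (hν : ∀ i, μ.map (M i) = ν)
    (hMM : iIndepFun M μ) (hPM : IndepFun (fun ω i => P i ω) (fun ω i => M i ω) μ) :
    ∃ C : ℝ, ∀ (A : Set (X × ℝ)) (s I : ℝ), MeasurableSet A → 0 ≤ s → s ≤ 1 / 2 → 0 ≤ I →
      (∀ p, ν {m | (m, p) ∈ A} ≤ ENNReal.ofReal s) →
      ∫⁻ p, ν {m | (m, p) ∈ A} = ENNReal.ofReal I →
      |μ.real {ω | ∀ i, (M i ω, P i ω) ∉ A} - Real.exp (-((intensity μ P).toReal * I))| ≤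
        2 * √(C * s * I) + 2 * s * ((intensity μ P).toReal * I) := by
  obtain ⟨C, hC, hbound⟩ := h.exists_lintegral_tsum_sq_le
  refine ⟨C.toReal, fun A s I hA hs0 hs hI hAs hAI => ?_⟩
  set f : ℝ → ℝ≥0∞ := fun p => ν {m | (m, p) ∈ A}
  have hf : Measurable f := measurable_measure_prodMk_right hA
  set c : ℝ := (intensity μ P).toReal * I with hc_def
  have hc : 0 ≤ c := mul_nonneg ENNReal.toReal_nonneg hI
  -- Conditionally on the points, `T` is the expected number of marked points in `A`. Its mean is
  -- `c`, and its variance is at most `C * s * I`.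
  set T : Ω → ℝ≥0∞ := fun ω => ∑' i, f (P i ω)
  have hT : Measurable T := Measurable.tsum fun i => hf.comp (h.measurable i)
  have hTint : ∫⁻ ω, T ω ∂μ = ENNReal.ofReal c := by
    rw [lintegral_tsum_points h.measurable hf, h.intensityMeasure_eq, lintegral_smul_measure, hAI,
      smul_eq_mul, hc_def, ENNReal.ofReal_mul ENNReal.toReal_nonneg,
      ENNReal.ofReal_toReal h.intensity_lt_top.ne]
  have hTsq : ∫⁻ ω, T ω ^ 2 ∂μ ≤ ENNReal.ofReal (c ^ 2 + C.toReal * s * I) := by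
    refine (hbound f _ hf hAs).trans_eq ?_
    rw [hAI, ENNReal.ofReal_add (by positivity) (by positivity), ENNReal.ofReal_pow hc, hc_def,
      ENNReal.ofReal_mul ENNReal.toReal_nonneg, ENNReal.ofReal_toReal h.intensity_lt_top.ne,
      ENNReal.ofReal_mul (by positivity), ENNReal.ofReal_mul ENNReal.toReal_nonneg,
      ENNReal.ofReal_toReal hC.ne]
  have hTfin : ∀ᵐ ω ∂μ, T ω < ∞ :=
    ae_lt_top hT (by rw [hTint]; exact ENNReal.ofReal_ne_top)
  set S : Ω → ℝ := fun ω => (T ω).toReal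
  have hSint : Integrable S μ :=
    integrable_toReal_of_lintegral_ne_top hT.aemeasurable (by rw [hTint]; exact ENNReal.ofReal_ne_top)
  have hSmean : ∫ ω, S ω ∂μ = c := by
    rw [integral_toReal hT.aemeasurable hTfin, hTint, ENNReal.toReal_ofReal hc]
  have hSsq_eq : ∀ ω, S ω ^ 2 = (T ω ^ 2).toReal := fun ω => (ENNReal.toReal_pow _ _).symm
  have hSsq_int : Integrable (fun ω => S ω ^ 2) μ := by
    simp_rw [hSsq_eq]
    exact integrable_toReal_of_lintegral_ne_top (hT.pow_const 2).aemeasurable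
      (hTsq.trans_lt ENNReal.ofReal_lt_top).ne
  have hSsq : ∫ ω, S ω ^ 2 ∂μ ≤ c ^ 2 + C.toReal * s * I := by
    simp_rw [hSsq_eq]
    rw [integral_toReal (hT.pow_const 2).aemeasurable
      (hTfin.mono fun ω hω => ENNReal.pow_lt_top hω)]
    exact ENNReal.toReal_le_of_le_ofReal (by positivity) hTsq
  have hdev_int : Integrable (fun ω => |S ω - c|) μ := (hSint.sub (integrable_const c)).abs
  have hdev : ∫ ω, |S ω - c| ∂μ ≤ √(C.toReal * s * I) := by
    refine Real.le_sqrt_of_sq_le ?_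
    -- Integrating `(|S - c| - m) ^ 2 ≥ 0` bounds `m ^ 2` by the variance.
    set m := ∫ ω, |S ω - c| ∂μ with hm
    have hexp : ∀ ω, (|S ω - c| - m) ^ 2 =
        S ω ^ 2 - 2 * c * S ω - 2 * m * |S ω - c| + (c ^ 2 + m ^ 2) := fun ω => by
      have := sq_abs (S ω - c)
      linear_combination this
    have hnn : 0 ≤ ∫ ω, (|S ω - c| - m) ^ 2 ∂μ := integral_nonneg fun ω => sq_nonneg _
    simp_rw [hexp] at hnn
    have hi : Integrable (fun ω => S ω ^ 2 - 2 * c * S ω) μ := hSsq_int.sub (hSint.const_mul _)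
    have hi' : Integrable (fun ω => S ω ^ 2 - 2 * c * S ω - 2 * m * |S ω - c|) μ :=
      hi.sub (hdev_int.const_mul _)
    rw [integral_add hi' (integrable_const _), integral_sub hi (hdev_int.const_mul _),
      integral_sub hSsq_int (hSint.const_mul _), integral_const_mul, integral_const_mul, ← hm,
      hSmean, integral_const] at hnn
    simp only [probReal_univ, one_smul] at hnn
    nlinarith
  set W : Ω → ℝ≥0∞ := fun ω => ∏' i, (1 - f (P i ω))
  have hWle : ∀ ω, W ω ≤ 1 := fun ω => by
    refine tprod_le_of_prod_le' le_rfl fun F => ?_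
    exact Finset.prod_le_one' fun i _ => tsub_le_self
  have hWm : Measurable W := by
    -- Factors at most one make the product an infimum over the countably many finite subsets, hence
    -- measurable.
    have hW : W = fun ω => ⨅ F : Finset ℤ, ∏ i ∈ F, (1 - f (P i ω)) :=
      funext fun ω => ENNReal.tprod_eq_iInf_prod fun i => tsub_le_self
    rw [hW]
    exact Measurable.iInf fun F => Finset.measurable_fun_prod F fun i _ =>
      (hf.comp (h.measurable i)).const_sub 1
  have hvoid : μ.real {ω | ∀ i, (M i ω, P i ω) ∉ A} = ∫ ω, (W ω).toReal ∂μ := by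
    rw [measureReal_def, measure_forall_notMem_eq h.measurable hM hν hMM hPM hA, integral_toReal
      hWm.aemeasurable (ae_of_all _ fun ω => (hWle ω).trans_lt ENNReal.one_lt_top)]
  have hWint : Integrable (fun ω => (W ω).toReal) μ := by
    refine integrable_toReal_of_lintegral_ne_top hWm.aemeasurable (ne_of_lt ?_)
    refine (lintegral_mono hWle).trans_lt ?_
    simp
  have hpt : ∀ᵐ ω ∂μ, |(W ω).toReal - Real.exp (-c)| ≤ 2 * |S ω - c| + 2 * s * c := by
    filter_upwards [hTfin] with ω hω
    obtain ⟨hlo, hup⟩ := tprod_one_sub_bounds (a := fun i => f (P i ω)) hs0 hs (fun i => hAs _) hω.ne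
    have hWfin : W ω ≠ ∞ := ((hWle ω).trans_lt ENNReal.one_lt_top).ne
    have hlo' : Real.exp (-((1 + 2 * s) * S ω)) ≤ (W ω).toReal :=
      (ENNReal.ofReal_le_iff_le_toReal hWfin).1 hlo
    have hup' : (W ω).toReal ≤ Real.exp (-(S ω)) :=
      ENNReal.toReal_le_of_le_ofReal (Real.exp_pos _).le hup
    have hS0 : 0 ≤ S ω := ENNReal.toReal_nonneg
    have h1 := exp_neg_sub_exp_neg_le (b := c) hS0
    have h2 := exp_neg_sub_exp_neg_le (b := (1 + 2 * s) * S ω) hc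
    -- The factor `2` bounds `1 + 2 * s`, and the drift `2 * s * c` is the cost of replacing `1 - b`
    -- by an exponential.
    have h3 : |c - (1 + 2 * s) * S ω| ≤ 2 * |S ω - c| + 2 * s * c := by
      have : c - (1 + 2 * s) * S ω = -((1 + 2 * s) * (S ω - c)) - 2 * s * c := by ring
      rw [this]
      refine (abs_sub _ _).trans ?_
      rw [abs_neg, abs_mul, abs_of_nonneg (by positivity : 0 ≤ 1 + 2 * s),
        abs_of_nonneg (by positivity : 0 ≤ 2 * s * c)]
      gcongr
      linarith
    have h4 : 0 ≤ 2 * s * c := by positivity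
    have h5 := abs_nonneg (S ω - c)
    rw [abs_le]
    constructor <;> linarith
  have hconst : Real.exp (-c) = ∫ _, Real.exp (-c) ∂μ := by simp
  rw [hvoid, hconst, ← integral_sub hWint (integrable_const _)]
  refine abs_integral_le_integral_abs.trans ?_
  have hbd_int : Integrable (fun ω => 2 * |S ω - c| + 2 * s * c) μ :=
    (hdev_int.const_mul 2).add (integrable_const _)
  refine (integral_mono_ae (hWint.sub (integrable_const _)).abs hbd_int hpt).trans ?_
  rw [integral_add (hdev_int.const_mul 2) (integrable_const _), integral_const_mul]
  simp only [integral_const, probReal_univ, one_smul]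
  linarith

end VoidProbability

/-! ### Poisson limit of void probabilities -/

section VoidLimit

variable {Ω X : Type*} [MeasurableSpace Ω] [MeasurableSpace X] {μ : Measure Ω}
  [IsProbabilityMeasure μ] {P : ℤ → Ω → ℝ} {M : ℤ → Ω → X} {ν : Measure X}

lemma IsBrillingerMixing.tendsto_measureReal_forall_notMem (h : IsBrillingerMixing μ P)
    [IsProbabilityMeasure ν] (hM : ∀ i, Measurable (M i)) (hν : ∀ i, μ.map (M i) = ν)
    (hMM : iIndepFun M μ) (hPM : IndepFun (fun ω i => P i ω) (fun ω i => M i ω) μ)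
    {A : ℝ → Set (X × ℝ)} (hA : ∀ ϱ, MeasurableSet (A ϱ)) {s : ℝ → ℝ≥0∞}
    (hs : Tendsto s atTop (𝓝 0)) (hAs : ∀ ϱ p, ν {m | (m, p) ∈ A ϱ} ≤ s ϱ) {I : ℝ} (hI : 0 ≤ I)
    (hAI : Tendsto (fun ϱ => ∫⁻ p, ν {m | (m, p) ∈ A ϱ}) atTop (𝓝 (ENNReal.ofReal I))) :
    Tendsto (fun ϱ => μ.real {ω | ∀ i, (M i ω, P i ω) ∉ A ϱ}) atTop
      (𝓝 (Real.exp (-((intensity μ P).toReal * I)))) := by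
  obtain ⟨C, hC⟩ := h.exists_abs_measureReal_sub_exp_le hM hν hMM hPM
  set l := (intensity μ P).toReal
  set J : ℝ → ℝ := fun ϱ => (∫⁻ p, ν {m | (m, p) ∈ A ϱ}).toReal
  set t : ℝ → ℝ := fun ϱ => (s ϱ).toReal
  have ht : Tendsto t atTop (𝓝 0) := by
    rw [← ENNReal.toReal_zero]
    exact (ENNReal.tendsto_toReal ENNReal.zero_ne_top).comp hs
  have hJ : Tendsto J atTop (𝓝 I) := by
    have := (ENNReal.tendsto_toReal ENNReal.ofReal_ne_top).comp hAI
    rwa [ENNReal.toReal_ofReal hI] at this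
  have hbound : ∀ᶠ ϱ in atTop,
      |μ.real {ω | ∀ i, (M i ω, P i ω) ∉ A ϱ} - Real.exp (-(l * J ϱ))| ≤
        2 * √(C * t ϱ * J ϱ) + 2 * t ϱ * (l * J ϱ) := by
    -- For small `ϱ` the bound `s ϱ` and the integral may be infinite or too large; only the tail is
    -- used.
    filter_upwards [ht.eventually_le_const (by norm_num : (0 : ℝ) < 1 / 2),
      hs.eventually_lt_const ENNReal.zero_lt_top,
      hAI.eventually_lt_const ENNReal.ofReal_lt_top] with ϱ h1 h2 h3
    refine hC (A ϱ) (t ϱ) (J ϱ) (hA ϱ) ENNReal.toReal_nonneg h1 ENNReal.toReal_nonneg ?_ ?_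
    · rw [ENNReal.ofReal_toReal h2.ne]
      exact hAs ϱ
    · rw [ENNReal.ofReal_toReal h3.ne]
  have hzero : Tendsto (fun ϱ => 2 * √(C * t ϱ * J ϱ) + 2 * t ϱ * (l * J ϱ)) atTop (𝓝 0) := by
    have h1 : Tendsto (fun ϱ => C * t ϱ * J ϱ) atTop (𝓝 (C * 0 * I)) := (ht.const_mul C).mul hJ
    have h2 := (Real.continuous_sqrt.tendsto _).comp h1
    have h3 := (h2.const_mul 2).add ((ht.const_mul 2).mul (hJ.const_mul l))
    simpa using h3
  have hdiff : Tendsto (fun ϱ => μ.real {ω | ∀ i, (M i ω, P i ω) ∉ A ϱ} - Real.exp (-(l * J ϱ)))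
      atTop (𝓝 0) := squeeze_zero_norm' hbound hzero
  have hexp : Tendsto (fun ϱ => Real.exp (-(l * J ϱ))) atTop (𝓝 (Real.exp (-(l * I)))) :=
    (Real.continuous_exp.tendsto _).comp (hJ.const_mul l).neg
  simpa using hdiff.add hexp

end VoidLimit

/-! ### Geometry of covering a point by a cylinder -/

section Geometry

/-- The signed length of the projection of `x` on the direction `(cos θ, sin θ)`. -/
def normalCoord (x : Plane) (θ : ℝ) : ℝ := x 0 * Real.cos θ + x 1 * Real.sin θ

/-- The marked points `((θ, r), p)` whose cylinder covers `x`. -/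
def coverSet (x : Plane) : Set ((ℝ × ℝ) × ℝ) := {z | |normalCoord x z.1.1 - z.2| ≤ z.1.2}

lemma abs_normalCoord_le (x : Plane) (θ : ℝ) : |normalCoord x θ| ≤ ‖x‖ := by
  rw [EuclideanSpace.norm_eq]
  refine Real.abs_le_sqrt ?_
  simp only [Fin.sum_univ_two, Real.norm_eq_abs, sq_abs, normalCoord]
  nlinarith [sq_nonneg (x 0 * Real.sin θ - x 1 * Real.cos θ), Real.sin_sq_add_cos_sq θ]

lemma normalCoord_sub (x y : Plane) (θ : ℝ) :
    normalCoord (x - y) θ = normalCoord x θ - normalCoord y θ := by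
  simp [normalCoord]; ring

lemma normalCoord_smul (c : ℝ) (x : Plane) (θ : ℝ) :
    normalCoord (c • x) θ = c * normalCoord x θ := by
  simp [normalCoord]; ring

lemma measurable_normalCoord : Measurable fun z : Plane × ℝ => normalCoord z.1 z.2 := by
  unfold normalCoord
  fun_prop

/-- The normal coordinate does not increase lengths; conversely, the foot of the perpendicular from
`x` realises the distance to the line. -/
lemma mem_line_add_closedBall {p θ r : ℝ} {x : Plane} :
    x ∈ line p θ + Metric.closedBall (0 : Plane) r ↔ |normalCoord x θ - p| ≤ r := by
  rw [Set.mem_add]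
  constructor
  · rintro ⟨a, ha, b, hb, rfl⟩
    have ha' : normalCoord a θ = p := ha
    have hab := normalCoord_sub (a + b) a θ
    rw [add_sub_cancel_left, ha'] at hab
    rw [← hab]
    exact (abs_normalCoord_le b θ).trans (mem_closedBall_zero_iff.1 hb)
  · intro h
    have hcs := Real.sin_sq_add_cos_sq θ
    set u : Plane := !₂[Real.cos θ, Real.sin θ]
    have hu : normalCoord u θ = 1 := by
      simp [normalCoord, u]
      linarith
    have hun : ‖u‖ = 1 := by
      rw [EuclideanSpace.norm_eq]
      simp [u, Fin.sum_univ_two]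
    refine ⟨x - (normalCoord x θ - p) • u, ?_, (normalCoord x θ - p) • u, ?_, sub_add_cancel _ _⟩
    · change normalCoord (x - (normalCoord x θ - p) • u) θ = p
      rw [normalCoord_sub, normalCoord_smul, hu]
      ring
    · rw [mem_closedBall_zero_iff, norm_smul, hun, mul_one]
      exact h

lemma notMem_cylinderProcess_iff {Ω : Type*} {P Φ R : ℤ → Ω → ℝ} {ω : Ω} {x : Plane} :
    x ∉ cylinderProcess P Φ R ω ↔ ∀ i, ((Φ i ω, R i ω), P i ω) ∉ coverSet x := by
  simp only [cylinderProcess, Set.mem_iUnion, mem_line_add_closedBall, not_exists]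
  rfl

lemma measurableSet_coverSet (x : Plane) : MeasurableSet (coverSet x) := by
  unfold coverSet normalCoord
  exact measurableSet_le (by fun_prop) (by fun_prop)

/-- In polar coordinates the normal coordinate is `‖x‖ cos(θ - arg x)`, and the cosine takes each
value countably often. -/
lemma countable_normalCoord_eq {x : Plane} (hx : x ≠ 0) (c : ℝ) :
    {θ | normalCoord x θ = c}.Countable := by
  set z : ℂ := ⟨x 0, x 1⟩
  have hz0 : ‖z‖ ≠ 0 := by
    rw [norm_ne_zero_iff]
    intro h0
    refine hx ?_
    ext i
    fin_cases i
    · exact congrArg Complex.re h0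
    · exact congrArg Complex.im h0
  have hcoord : ∀ θ, normalCoord x θ = ‖z‖ * Real.cos (θ - z.arg) := fun θ => by
    have h1 : ‖z‖ * Real.cos z.arg = x 0 := Complex.norm_mul_cos_arg z
    have h2 : ‖z‖ * Real.sin z.arg = x 1 := Complex.norm_mul_sin_arg z
    rw [normalCoord, ← h1, ← h2, Real.cos_sub]
    ring
  rcases Set.eq_empty_or_nonempty {θ | normalCoord x θ = c} with h | ⟨θ₀, hθ₀⟩
  · rw [h]; exact Set.countable_empty
  · refine ((Set.countable_range fun k : ℤ => 2 * k * Real.pi + (θ₀ - z.arg) + z.arg).union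
      (Set.countable_range fun k : ℤ => 2 * k * Real.pi - (θ₀ - z.arg) + z.arg)).mono ?_
    intro θ hθ
    have heq : Real.cos (θ₀ - z.arg) = Real.cos (θ - z.arg) := by
      refine mul_left_cancel₀ hz0 ?_
      rw [← hcoord, ← hcoord]
      exact Eq.trans hθ₀ (Eq.symm hθ)
    obtain ⟨k, hk | hk⟩ := Real.cos_eq_cos_iff.1 heq
    · exact Or.inl ⟨k, by simp only; linarith⟩
    · exact Or.inr ⟨k, by simp only; linarith⟩

variable {ν : Measure (ℝ × ℝ)}

lemma measure_normalCoord_eq_zero [NullSingletonClass (ν.map Prod.fst)] {x : Plane} (hx : x ≠ 0)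
    (c : ℝ) :
    ν {m | normalCoord x m.1 = c} = 0 := by
  have hc := countable_normalCoord_eq hx c
  have := hc.measure_zero (ν.map Prod.fst)
  rwa [Measure.map_apply measurable_fst hc.measurableSet] at this

/-- A bound for the square of the largest probability that a random cylinder with generic mark
distribution `ν` and given location `p` covers `ϱ • x`. -/
def coverBound (ν : Measure (ℝ × ℝ)) (x : Plane) (ϱ : ℝ) : ℝ≥0∞ :=
  (ν.prod ν) {z | |ϱ| * |normalCoord x z.1.1 - normalCoord x z.2.1| ≤ z.1.2 + z.2.2}

/-- The squared probability is that of two independent marks both covering at `p`. The triangle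
inequality then eliminates `p`, which makes the bound uniform. -/
lemma measure_coverSet_le [SFinite ν] (x : Plane) (ϱ p : ℝ) :
    ν {m | (m, p) ∈ coverSet (ϱ • x)} ≤ coverBound ν x ϱ ^ (2⁻¹ : ℝ) := by
  rw [ENNReal.le_rpow_inv_iff (by norm_num)]
  have h2 : ∀ a : ℝ≥0∞, a ^ (2 : ℝ) = a * a := fun a => by
    rw [ENNReal.rpow_two, sq]
  rw [h2, ← Measure.prod_prod]
  refine measure_mono ?_
  rintro ⟨m, m'⟩ ⟨h1, h2⟩
  simp only [coverSet, Set.mem_ofPred_eq, normalCoord_smul] at h1 h2 ⊢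
  rw [← abs_mul]
  have h3 : ϱ * (normalCoord x m.1 - normalCoord x m'.1) =
      (ϱ * normalCoord x m.1 - p) - (ϱ * normalCoord x m'.1 - p) := by ring
  rw [h3]
  exact (abs_sub _ _).trans (add_le_add h1 h2)

/-- Two independent angles almost surely give different normal coordinates, and for such a fixed
pair of marks the defining inequality fails for large `ϱ`. -/
lemma tendsto_coverBound [IsProbabilityMeasure ν] [NullSingletonClass (ν.map Prod.fst)] {x : Plane}
    (hx : x ≠ 0) : Tendsto (fun ϱ => coverBound ν x ϱ ^ (2⁻¹ : ℝ)) atTop (𝓝 0) := by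
  have hmeas : Measurable fun m : ℝ × ℝ => normalCoord x m.1 := by
    unfold normalCoord
    fun_prop
  have hne : ∀ᵐ z ∂(ν.prod ν), normalCoord x z.1.1 ≠ normalCoord x z.2.1 := by
    have hms : MeasurableSet {z : (ℝ × ℝ) × (ℝ × ℝ) |
        normalCoord x z.1.1 = normalCoord x z.2.1} :=
      measurableSet_eq_fun (hmeas.comp measurable_fst) (hmeas.comp measurable_snd)
    rw [ae_iff]
    simp only [ne_eq, not_not]
    rw [Measure.measure_prod_null hms]
    refine ae_of_all _ fun m => ?_
    have := measure_normalCoord_eq_zero (ν := ν) hx (normalCoord x m.1)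
    simpa [eq_comm] using this
  have h0 : Tendsto (fun ϱ => coverBound ν x ϱ) atTop (𝓝 ((ν.prod ν) ∅)) := by
    refine tendsto_measure_of_ae_tendsto_indicator_of_isFiniteMeasure atTop MeasurableSet.empty
      (fun ϱ => ?_) ?_
    · exact measurableSet_le (((hmeas.comp measurable_fst).sub
        (hmeas.comp measurable_snd)).abs.const_mul _) (by fun_prop)
    · filter_upwards [hne] with z hz
      have hpos : 0 < |normalCoord x z.1.1 - normalCoord x z.2.1| := abs_pos.2 (sub_ne_zero.2 hz)
      filter_upwards [eventually_gt_atTop 0, (tendsto_id.atTop_mul_const hpos).eventually_gt_atTop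
        (z.1.2 + z.2.2)] with ϱ h1 h2
      simp only [Set.mem_empty_iff_false, iff_false]
      refine not_le.2 ?_
      rwa [abs_of_pos h1]
  rw [measure_empty] at h0
  have := (ENNReal.continuous_rpow_const (y := (2⁻¹ : ℝ))).tendsto 0 |>.comp h0
  rwa [ENNReal.zero_rpow_of_pos (by norm_num)] at this

lemma setOf_mem_coverSet (x : Plane) (m : ℝ × ℝ) :
    {p | (m, p) ∈ coverSet x} = Set.Icc (normalCoord x m.1 - m.2) (normalCoord x m.1 + m.2) := by
  ext p
  simp only [coverSet, Set.mem_ofPred_eq, Set.mem_Icc, abs_le]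
  constructor <;> rintro ⟨h1, h2⟩ <;> constructor <;> linarith

lemma volume_setOf_mem_coverSet (x : Plane) (m : ℝ × ℝ) :
    volume {p | (m, p) ∈ coverSet x} = ENNReal.ofReal (2 * m.2) := by
  rw [setOf_mem_coverSet, Real.volume_Icc]
  congr 1
  ring

lemma lintegral_measure_section [SFinite ν] {A : Set ((ℝ × ℝ) × ℝ)} (hA : MeasurableSet A) :
    ∫⁻ p, ν {m | (m, p) ∈ A} = ∫⁻ m, volume {p | (m, p) ∈ A} ∂ν :=
  (Measure.prod_apply_symm hA).symm.trans (Measure.prod_apply hA)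

lemma lintegral_measure_coverSet [SFinite ν] (x : Plane) :
    ∫⁻ p, ν {m | (m, p) ∈ coverSet x} = ∫⁻ m, ENNReal.ofReal (2 * m.2) ∂ν := by
  rw [lintegral_measure_section (measurableSet_coverSet x)]
  exact lintegral_congr fun m => volume_setOf_mem_coverSet x m

/-- For a fixed mark the two sets of locations are intervals of radius `r` whose centres are `ϱ *
|normalCoord (x - y) θ|` apart. They are eventually disjoint unless that coordinate vanishes, which
has probability zero; twice the interval length dominates. -/
lemma tendsto_lintegral_measure_coverSet_union [IsProbabilityMeasure ν]
    [NullSingletonClass (ν.map Prod.fst)] {x y : Plane} (hxy : x ≠ y)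
    (hfin : ∫⁻ m, ENNReal.ofReal (2 * m.2) ∂ν ≠ ∞) :
    Tendsto (fun ϱ : ℝ => ∫⁻ p, ν {m | (m, p) ∈ coverSet (ϱ • x) ∪ coverSet (ϱ • y)}) atTop
      (𝓝 (2 * ∫⁻ m, ENNReal.ofReal (2 * m.2) ∂ν)) := by
  have hmeas : ∀ ϱ : ℝ, MeasurableSet (coverSet (ϱ • x) ∪ coverSet (ϱ • y)) := fun ϱ =>
    (measurableSet_coverSet _).union (measurableSet_coverSet _)
  simp_rw [lintegral_measure_section (hmeas _)]
  rw [← lintegral_const_mul _ (by fun_prop)]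
  refine tendsto_lintegral_filter_of_dominated_convergence
    (fun m => 2 * ENNReal.ofReal (2 * m.2))
    (Eventually.of_forall fun ϱ => measurable_measure_prodMk_left (hmeas ϱ))
    (Eventually.of_forall fun ϱ => ae_of_all _ fun m => ?_) ?_ ?_
  · refine (measure_union_le {p | (m, p) ∈ coverSet (ϱ • x)}
      {p | (m, p) ∈ coverSet (ϱ • y)}).trans_eq ?_
    rw [volume_setOf_mem_coverSet, volume_setOf_mem_coverSet, two_mul (ENNReal.ofReal _)]
  · rw [lintegral_const_mul _ (by fun_prop)]
    exact ENNReal.mul_ne_top ENNReal.ofNat_ne_top hfin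
  · have hne : ∀ᵐ m ∂ν, normalCoord (x - y) m.1 ≠ 0 := by
      rw [ae_iff]
      simpa using measure_normalCoord_eq_zero (ν := ν) (sub_ne_zero.2 hxy) 0
    filter_upwards [hne] with m hm
    refine tendsto_const_nhds.congr' ?_
    have hpos : 0 < |normalCoord (x - y) m.1| := abs_pos.2 hm
    filter_upwards [eventually_gt_atTop 0, (tendsto_id.atTop_mul_const hpos).eventually_gt_atTop
      (2 * m.2)] with ϱ h1 h2
    have hdisj : Disjoint {p | (m, p) ∈ coverSet (ϱ • x)} {p | (m, p) ∈ coverSet (ϱ • y)} := by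
      rw [Set.disjoint_left]
      intro p hp hp'
      simp only [coverSet, Set.mem_ofPred_eq, normalCoord_smul] at hp hp'
      have h3 : ϱ * normalCoord (x - y) m.1 =
          (ϱ * normalCoord x m.1 - p) - (ϱ * normalCoord y m.1 - p) := by
        rw [normalCoord_sub]; ring
      have h4 := abs_sub (ϱ * normalCoord x m.1 - p) (ϱ * normalCoord y m.1 - p)
      rw [← h3, abs_mul, abs_of_pos h1] at h4
      simp only [id] at h2
      linarith
    have hunion := measure_union (μ := (volume : Measure ℝ)) hdisj
      (by rw [setOf_mem_coverSet]; exact measurableSet_Icc)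
    rw [volume_setOf_mem_coverSet, volume_setOf_mem_coverSet, ← two_mul] at hunion
    exact hunion.symm

end Geometry

/-! ### One- and two-point vacancy probabilities -/

section CoverageProbability

variable {Ω : Type*} [MeasurableSpace Ω] {μ : Measure Ω} {P Φ R : ℤ → Ω → ℝ} {Φ₀ R₀ : Ω → ℝ}

lemma nullSingletonClass_of_continuous_cdf {ρ : Measure ℝ} [IsProbabilityMeasure ρ]
    (h : Continuous (cdf ρ)) : NullSingletonClass ρ := ⟨fun a => by
  rw [← measure_cdf ρ, StieltjesFunction.measure_singleton,
    h.continuousAt.continuousWithinAt.leftLim_eq, sub_self, ENNReal.ofReal_zero]⟩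

lemma lintegral_ofReal_two_mul_mark (hm : IsIndependentMarking μ P Φ R Φ₀ R₀)
    (hR₀ : Integrable R₀ μ) :
    ∫⁻ m, ENNReal.ofReal (2 * m.2) ∂(μ.map fun ω => (Φ₀ ω, R₀ ω)) =
      ENNReal.ofReal (∫ ω, volume.real (Set.Icc (-R₀ ω) (R₀ ω)) ∂μ) := by
  have hvol : (fun ω => volume.real (Set.Icc (-R₀ ω) (R₀ ω))) =ᵐ[μ] fun ω => 2 * R₀ ω := by
    filter_upwards [hm.radius_nonneg] with ω hω
    rw [Real.volume_real_Icc_of_le (by linarith)]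
    ring
  rw [lintegral_map (by fun_prop) (hm.measurable_angle.prodMk hm.measurable_radius),
    integral_congr_ae hvol, ofReal_integral_eq_lintegral_ofReal (hR₀.const_mul 2)]
  filter_upwards [hm.radius_nonneg] with ω hω
  simpa using hω

lemma measurableSet_notMem_cylinderProcess (hm : IsIndependentMarking μ P Φ R Φ₀ R₀)
    (hP : ∀ i, Measurable (P i)) (ϱ : ℝ) :
    MeasurableSet {z : Ω × Plane | ϱ • z.2 ∉ cylinderProcess P Φ R z.1} := by
  simp only [notMem_cylinderProcess_iff, Set.ofPred_forall]
  refine MeasurableSet.iInter fun i => ?_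
  have h1 := hm.measurable_angles i
  have h2 := hm.measurable_radii i
  have h3 := hP i
  have h4 : Measurable fun z : Ω × Plane => normalCoord (ϱ • z.2) (Φ i z.1) :=
    measurable_normalCoord.comp ((measurable_snd.const_smul ϱ).prodMk (h1.comp measurable_fst))
  exact (measurableSet_le (h4.sub (h3.comp measurable_fst)).abs (h2.comp measurable_fst)).compl

variable [IsProbabilityMeasure μ]

lemma nullSingletonClass_map_fst_mark (hm : IsIndependentMarking μ P Φ R Φ₀ R₀)
    (hG : Continuous (cdf (μ.map Φ₀))) :
    NullSingletonClass ((μ.map fun ω => (Φ₀ ω, R₀ ω)).map Prod.fst) := by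
  have := Measure.isProbabilityMeasure_map (μ := μ) hm.measurable_angle.aemeasurable
  rw [Measure.map_map measurable_fst (hm.measurable_angle.prodMk hm.measurable_radius)]
  exact nullSingletonClass_of_continuous_cdf (ρ := μ.map Φ₀) hG

/-- The mean number of cylinders covering `ϱ • x` does not depend on `ϱ`; the limit only serves to
make each individual covering probability small, for which `x ≠ 0` is needed. -/
lemma tendsto_measureReal_notMem_cylinderProcess (hP : IsBrillingerMixing μ P)
    (hm : IsIndependentMarking μ P Φ R Φ₀ R₀) (hR₀ : Integrable R₀ μ)
    (hG : Continuous (cdf (μ.map Φ₀))) {x : Plane} (hx : x ≠ 0) :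
    Tendsto (fun ϱ : ℝ => μ.real {ω | ϱ • x ∉ cylinderProcess P Φ R ω}) atTop
      (𝓝 (Real.exp (-((intensity μ P).toReal *
        ∫ ω, volume.real (Set.Icc (-R₀ ω) (R₀ ω)) ∂μ)))) := by
  have hmark : Measurable fun ω => (Φ₀ ω, R₀ ω) := hm.measurable_angle.prodMk hm.measurable_radius
  have := Measure.isProbabilityMeasure_map (μ := μ) hmark.aemeasurable
  have := nullSingletonClass_map_fst_mark hm hG
  simp_rw [notMem_cylinderProcess_iff]
  refine hP.tendsto_measureReal_forall_notMem (ν := μ.map fun ω => (Φ₀ ω, R₀ ω))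
    (fun i => (hm.measurable_angles i).prodMk (hm.measurable_radii i))
    (fun i => (hm.identDistrib i).map_eq) hm.iIndep_marks hm.indep_points_marks
    (fun ϱ => measurableSet_coverSet _) (tendsto_coverBound hx)
    (fun ϱ p => measure_coverSet_le x ϱ p) (integral_nonneg fun ω => measureReal_nonneg) ?_
  simp_rw [lintegral_measure_coverSet]
  rw [lintegral_ofReal_two_mul_mark hm hR₀]
  exact tendsto_const_nhds

lemma tendsto_measureReal_notMem_cylinderProcess_pair (hP : IsBrillingerMixing μ P)
    (hm : IsIndependentMarking μ P Φ R Φ₀ R₀) (hR₀ : Integrable R₀ μ)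
    (hG : Continuous (cdf (μ.map Φ₀))) {x y : Plane} (hx : x ≠ 0) (hy : y ≠ 0) (hxy : x ≠ y) :
    Tendsto (fun ϱ : ℝ => μ.real
      {ω | ϱ • x ∉ cylinderProcess P Φ R ω ∧ ϱ • y ∉ cylinderProcess P Φ R ω}) atTop
      (𝓝 (Real.exp (-((intensity μ P).toReal *
        ∫ ω, volume.real (Set.Icc (-R₀ ω) (R₀ ω)) ∂μ)) ^ 2)) := by
  have hmark : Measurable fun ω => (Φ₀ ω, R₀ ω) := hm.measurable_angle.prodMk hm.measurable_radius
  have := Measure.isProbabilityMeasure_map (μ := μ) hmark.aemeasurable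
  have := nullSingletonClass_map_fst_mark hm hG
  have hI : 0 ≤ ∫ ω, volume.real (Set.Icc (-R₀ ω) (R₀ ω)) ∂μ :=
    integral_nonneg fun ω => measureReal_nonneg
  have hset : ∀ ϱ : ℝ,
      {ω | ϱ • x ∉ cylinderProcess P Φ R ω ∧ ϱ • y ∉ cylinderProcess P Φ R ω} =
      {ω | ∀ i, ((Φ i ω, R i ω), P i ω) ∉ coverSet (ϱ • x) ∪ coverSet (ϱ • y)} := fun ϱ => by
    ext ω
    simp only [Set.mem_ofPred_eq, notMem_cylinderProcess_iff, Set.mem_union, not_or, forall_and]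
  have hexp : Real.exp (-((intensity μ P).toReal *
      ∫ ω, volume.real (Set.Icc (-R₀ ω) (R₀ ω)) ∂μ)) ^ 2 =
      Real.exp (-((intensity μ P).toReal *
        (2 * ∫ ω, volume.real (Set.Icc (-R₀ ω) (R₀ ω)) ∂μ))) := by
    rw [← Real.exp_nat_mul]
    congr 1
    push_cast
    ring
  simp_rw [hset]
  rw [hexp]
  have hs := (tendsto_coverBound (ν := μ.map fun ω => (Φ₀ ω, R₀ ω)) hx).add
    (tendsto_coverBound (ν := μ.map fun ω => (Φ₀ ω, R₀ ω)) hy)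
  rw [add_zero] at hs
  refine hP.tendsto_measureReal_forall_notMem (ν := μ.map fun ω => (Φ₀ ω, R₀ ω))
    (fun i => (hm.measurable_angles i).prodMk (hm.measurable_radii i))
    (fun i => (hm.identDistrib i).map_eq) hm.iIndep_marks hm.indep_points_marks
    (fun ϱ => (measurableSet_coverSet _).union (measurableSet_coverSet _)) hs
    (fun ϱ p => ?_) (by positivity) ?_
  · exact (measure_union_le {m | (m, p) ∈ coverSet (ϱ • x)} {m | (m, p) ∈ coverSet (ϱ • y)}).trans
      (add_le_add (measure_coverSet_le x ϱ p) (measure_coverSet_le y ϱ p))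
  · have hJ := lintegral_ofReal_two_mul_mark hm hR₀
    rw [ENNReal.ofReal_mul zero_le_two, ENNReal.ofReal_ofNat, ← hJ]
    exact tendsto_lintegral_measure_coverSet_union hxy (by rw [hJ]; exact ENNReal.ofReal_ne_top)

end CoverageProbability

/-! ### From point probabilities to mean-square convergence -/

section MeanSquare

variable {Ω Z : Type*} [MeasurableSpace Ω] [MeasurableSpace Z] {μ : Measure Ω}
  [IsProbabilityMeasure μ] {κ : Measure Z} [IsProbabilityMeasure κ]

lemma integrable_measureReal_section {E : Set (Ω × Z)} (hE : MeasurableSet E) :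
    Integrable (fun ω => κ.real {z | (ω, z) ∈ E}) μ := by
  have hm : Measurable fun ω => κ {z | (ω, z) ∈ E} := measurable_measure_prodMk_left hE
  refine Integrable.of_bound hm.ennreal_toReal.aestronglyMeasurable 1 (ae_of_all _ fun ω => ?_)
  rw [Real.norm_of_nonneg measureReal_nonneg]
  exact measureReal_le_one

lemma integral_measureReal_section {E : Set (Ω × Z)} (hE : MeasurableSet E) :
    ∫ ω, κ.real {z | (ω, z) ∈ E} ∂μ = ∫ z, μ.real {ω | (ω, z) ∈ E} ∂κ := by
  have h1 : Measurable fun ω => κ {z | (ω, z) ∈ E} := measurable_measure_prodMk_left hE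
  have h2 : Measurable fun z => μ {ω | (ω, z) ∈ E} := measurable_measure_prodMk_right hE
  simp only [measureReal_def]
  rw [integral_toReal h1.aemeasurable (ae_of_all _ fun _ => measure_lt_top _ _),
    integral_toReal h2.aemeasurable (ae_of_all _ fun _ => measure_lt_top _ _)]
  congr 1
  exact (Measure.prod_apply hE).symm.trans (Measure.prod_apply_symm hE)

lemma tendsto_integral_measureReal_section {E : ℝ → Set (Ω × Z)} (hE : ∀ ϱ, MeasurableSet (E ϱ))
    {a : ℝ} (h : ∀ᵐ z ∂κ, Tendsto (fun ϱ => μ.real {ω | (ω, z) ∈ E ϱ}) atTop (𝓝 a)) :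
    Tendsto (fun ϱ => ∫ ω, κ.real {z | (ω, z) ∈ E ϱ} ∂μ) atTop (𝓝 a) := by
  simp_rw [integral_measureReal_section (hE _)]
  have ha : a = ∫ _, a ∂κ := by simp
  rw [ha]
  refine tendsto_integral_filter_of_dominated_convergence (fun _ => 1)
    (Eventually.of_forall fun ϱ => ?_) (Eventually.of_forall fun ϱ => ae_of_all _ fun z => ?_)
    (integrable_const _) h
  · have hm : Measurable fun z => μ {ω | (ω, z) ∈ E ϱ} := measurable_measure_prodMk_right (hE ϱ)
    exact hm.ennreal_toReal.aestronglyMeasurable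
  · rw [Real.norm_of_nonneg measureReal_nonneg]
    exact measureReal_le_one

/-- Mean-square convergence of the `κ`-measure of a random set, from the convergence of its one-
and two-point probabilities. -/
lemma tendsto_integral_measureReal_section_sub_sq [NullSingletonClass κ]
    [MeasurableSingletonClass Z] [MeasurableEq Z] {E : ℝ → Set (Ω × Z)}
    (hE : ∀ ϱ, MeasurableSet (E ϱ)) {a : ℝ} {z₀ : Z}
    (h1 : ∀ x ≠ z₀, Tendsto (fun ϱ => μ.real {ω | (ω, x) ∈ E ϱ}) atTop (𝓝 a))
    (h2 : ∀ x ≠ z₀, ∀ y ≠ z₀, x ≠ y →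
      Tendsto (fun ϱ => μ.real {ω | (ω, x) ∈ E ϱ ∧ (ω, y) ∈ E ϱ}) atTop (𝓝 (a ^ 2))) :
    Tendsto (fun ϱ => ∫ ω, (κ.real {z | (ω, z) ∈ E ϱ} - a) ^ 2 ∂μ) atTop (𝓝 0) := by
  have hne : ∀ᵐ x ∂κ, x ≠ z₀ := by
    rw [ae_iff]
    simp
  have hmean := tendsto_integral_measureReal_section hE (hne.mono h1)
  have hE2 : ∀ ϱ, MeasurableSet {z : Ω × (Z × Z) | (z.1, z.2.1) ∈ E ϱ ∧ (z.1, z.2.2) ∈ E ϱ} :=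
    fun ϱ => by
      have e1 : Measurable fun z : Ω × (Z × Z) => (z.1, z.2.1) := by fun_prop
      have e2 : Measurable fun z : Ω × (Z × Z) => (z.1, z.2.2) := by fun_prop
      exact (e1 (hE ϱ)).inter (e2 (hE ϱ))
  have hne2 : ∀ᵐ z ∂(κ.prod κ), z.1 ≠ z₀ ∧ z.2 ≠ z₀ ∧ z.1 ≠ z.2 := by
    have hdiag : ∀ᵐ z ∂(κ.prod κ), z.1 ≠ z.2 := by
      have hms : MeasurableSet {z : Z × Z | z.1 = z.2} :=
        measurableSet_eq_fun measurable_fst measurable_snd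
      rw [ae_iff]
      simp only [ne_eq, not_not]
      rw [Measure.measure_prod_null hms]
      refine ae_of_all _ fun x => ?_
      have hset : Prod.mk x ⁻¹' {z : Z × Z | z.1 = z.2} = {x} := by
        ext y
        simp [eq_comm]
      simp only [hset, measure_singleton, Pi.zero_apply]
    filter_upwards [Measure.quasiMeasurePreserving_fst.ae hne,
      Measure.quasiMeasurePreserving_snd.ae hne, hdiag] with z hz1 hz2 hz3
    exact ⟨hz1, hz2, hz3⟩
  have hsecond := tendsto_integral_measureReal_section (κ := κ.prod κ) hE2
    (hne2.mono fun z hz => h2 z.1 hz.1 z.2 hz.2.1 hz.2.2)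
  -- Sampling two independent points from `κ` turns the squared mass into a two-point probability.
  have hsq : ∀ ϱ ω, (κ.prod κ).real {z : Z × Z | (ω, z.1) ∈ E ϱ ∧ (ω, z.2) ∈ E ϱ} =
      κ.real {z | (ω, z) ∈ E ϱ} ^ 2 := fun ϱ ω => by
    rw [sq, ← measureReal_prod_prod]
    rfl
  have hexpand : ∀ ϱ, ∫ ω, (κ.real {z | (ω, z) ∈ E ϱ} - a) ^ 2 ∂μ =
      ∫ ω, (κ.prod κ).real {z : Z × Z | (ω, z.1) ∈ E ϱ ∧ (ω, z.2) ∈ E ϱ} ∂μ -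
        2 * a * ∫ ω, κ.real {z | (ω, z) ∈ E ϱ} ∂μ + a ^ 2 := fun ϱ => by
    have hi1 := integrable_measureReal_section (μ := μ) (κ := κ) (hE ϱ)
    have hi2 := integrable_measureReal_section (μ := μ) (κ := κ.prod κ) (hE2 ϱ)
    simp only [Set.mem_ofPred_eq, hsq] at hi2
    have hpt : ∀ ω, (κ.real {z | (ω, z) ∈ E ϱ} - a) ^ 2 =
        κ.real {z | (ω, z) ∈ E ϱ} ^ 2 - 2 * a * κ.real {z | (ω, z) ∈ E ϱ} + a ^ 2 :=
      fun ω => by ring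
    have hi3 : Integrable (fun ω => κ.real {z | (ω, z) ∈ E ϱ} ^ 2 -
        2 * a * κ.real {z | (ω, z) ∈ E ϱ}) μ := hi2.sub (hi1.const_mul _)
    simp_rw [hpt, hsq]
    rw [integral_add hi3 (integrable_const _), integral_sub hi2 (hi1.const_mul _),
      integral_const_mul]
    simp
  simp_rw [hexpand]
  have hlim := (hsecond.sub (hmean.const_mul (2 * a))).add_const (a ^ 2)
  have hz : a ^ 2 - 2 * a * a + a ^ 2 = 0 := by ring
  rwa [hz] at hlim

end MeanSquare

/-! ### Rescaling the area fraction to the fixed window -/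

section AreaFraction

variable {Ω : Type*} {P Φ R : ℤ → Ω → ℝ}

lemma areaFraction_eq {K : Set Plane} (hKm : MeasurableSet K) {ϱ : ℝ} (hϱ : 0 < ϱ) (ω : Ω) :
    areaFraction P Φ R K ϱ ω =
      (cond (volume : Measure Plane) K).real {y | ϱ • y ∈ cylinderProcess P Φ R ω} := by
  have hset : cylinderProcess P Φ R ω ∩ ϱ • K =
      ϱ • (K ∩ {y | ϱ • y ∈ cylinderProcess P Φ R ω}) := by
    rw [Set.smul_set_inter₀ hϱ.ne', Set.inter_comm]
    congr 1
    ext x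
    rw [Set.mem_smul_set_iff_inv_smul_mem₀ hϱ.ne', Set.mem_ofPred_eq, smul_inv_smul₀ hϱ.ne']
  have hpos : 0 < |ϱ ^ Module.finrank ℝ Plane| := by positivity
  rw [areaFraction, hset, measureReal_def, measureReal_def, measureReal_def,
    Measure.addHaar_smul, Measure.addHaar_smul, cond_apply hKm, ENNReal.toReal_mul,
    ENNReal.toReal_mul, ENNReal.toReal_mul, ENNReal.toReal_ofReal hpos.le, ENNReal.toReal_inv,
    mul_div_mul_left _ _ hpos.ne', div_eq_inv_mul]

end AreaFraction

end PlanarCylinder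

end

/-! ### Mean-square limit of the area fraction -/

open PlanarCylinder in
theorem theorem1 {Ω : Type*} [MeasurableSpace Ω] (μ : Measure Ω) [IsProbabilityMeasure μ]
    (P Φ R : ℤ → Ω → ℝ) (Φ₀ R₀ : Ω → ℝ)
    (hP : PlanarCylinder.IsBrillingerMixing μ P)
    (hmarks : PlanarCylinder.IsIndependentMarking μ P Φ R Φ₀ R₀)
    (hR₀ : Integrable R₀ μ)
    (hG : Continuous (cdf (μ.map Φ₀)))
    (K : Set PlanarCylinder.Plane) (hK : IsCompact K) (hstar : StarConvex ℝ 0 K)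
    (hint : (0 : PlanarCylinder.Plane) ∈ interior K) :
    (∀ ϱ : ℝ, 0 < ϱ → MemLp (PlanarCylinder.areaFraction P Φ R K ϱ) 2 μ) ∧
      Tendsto
        (fun ϱ : ℝ => ∫ ω, (PlanarCylinder.areaFraction P Φ R K ϱ ω -
          (1 - Real.exp (-((PlanarCylinder.intensity μ P).toReal *
            ∫ ω', volume.real (Set.Icc (-R₀ ω') (R₀ ω')) ∂μ)))) ^ 2 ∂μ)
        atTop (𝓝 0) := by
  have hKpos : (volume : Measure Plane) K ≠ 0 :=
    (Measure.measure_pos_of_nonempty_interior _ ⟨0, hint⟩).ne'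
  have : IsProbabilityMeasure (cond (volume : Measure Plane) K) :=
    cond_isProbabilityMeasure_of_finite hKpos hK.measure_lt_top.ne
  have : NullSingletonClass (cond (volume : Measure Plane) K) :=
    ⟨fun x => cond_absolutelyContinuous (measure_singleton x)⟩
  have hE := measurableSet_notMem_cylinderProcess hmarks hP.measurable
  -- Passing to the vacant fraction, whose limit is the exponential itself, only changes the sign
  -- inside the square.
  have hfrac : ∀ ϱ : ℝ, 0 < ϱ → ∀ ω, areaFraction P Φ R K ϱ ω =
      1 - (cond (volume : Measure Plane) K).real {y | ϱ • y ∉ cylinderProcess P Φ R ω} := by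
    intro ϱ hϱ ω
    have hs : MeasurableSet {y : Plane | ϱ • y ∉ cylinderProcess P Φ R ω} :=
      measurable_prodMk_left (hE ϱ)
    rw [areaFraction_eq hK.measurableSet hϱ, ← probReal_compl_eq_one_sub hs]
    congr 1
    ext y
    simp
  refine ⟨fun ϱ hϱ => ?_, ?_⟩
  · have hm : Measurable fun ω => (cond (volume : Measure Plane) K)
        {y | ϱ • y ∉ cylinderProcess P Φ R ω} := measurable_measure_prodMk_left (hE ϱ)
    rw [funext (hfrac ϱ hϱ)]
    refine MemLp.of_bound (hm.ennreal_toReal.const_sub 1).aestronglyMeasurable 1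
      (ae_of_all _ fun ω => ?_)
    rw [Real.norm_of_nonneg (sub_nonneg.2 measureReal_le_one)]
    exact sub_le_self _ measureReal_nonneg
  · refine (tendsto_integral_measureReal_section_sub_sq (κ := cond (volume : Measure Plane) K) hE
      (z₀ := 0)
      (fun x hx => tendsto_measureReal_notMem_cylinderProcess hP hmarks hR₀ hG hx)
      (fun x hx y hy hxy =>
        tendsto_measureReal_notMem_cylinderProcess_pair hP hmarks hR₀ hG hx hy hxy)).congr' ?_
    filter_upwards [eventually_gt_atTop 0] with ϱ hϱ
    refine integral_congr_ae (ae_of_all _ fun ω => ?_)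
    simp only [hfrac ϱ hϱ]
    ring
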